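/- **Conventions.** All spaces are compactly generated Hausdorff and products are formed in that category. In $S_n$ the product is $\sigma\tau:=\tau\circ\sigma$. A (topological) operad $\mathscr C$ consists of spaces $\mathscr C(n)$, $n\ge 0$, with $\mathscr C(0)$ a point, continuous associative compositions $\gamma:\mathscr C(k)\times\mathscr C(m_1)\times\cdots\times\mathscr C(m_k)\to\mathscr C(m_1+\cdots+m_k)$, and a two-sided unit $1\in\mathscr C(1)$. The groups $S_n$ form a (discrete) operad $\mathscr S$, where $\gamma(\sigma;\tau_1,\dots,\tau_k)$ permutes the $i$-th block by $\tau_i$ and moves it to position $\sigma(i)$. A *group operad* $\mathscr G$ is a discrete operad whose terms $G_n$ are groups, whose unit is the identity of $G_1$, with a morphism of operads $\pi:\mathscr G\to\mathscr S$ consisting of homomorphisms, such that $\gamma(aa';b_1b_1',\dots,b_kb_k')=\gamma(a;b_1,\dots,b_k)\,\gamma(a';b'_{a^{-1}(1)},\dots,b'_{a^{-1}(k)})$, where $a(i):=(\pi a)(i)$. A *$\mathscr G$-operad* is a topological operad $\mathscr C$ with left actions of $G_n$ on $\mathscr C(n)$ by homeomorphisms such that $\gamma(\sigma a;\tau_1b_1,\dots,\tau_kb_k)=\gamma(\sigma;\tau_1,\dots,\tau_k)\,\gamma(a;b_{\sigma^{-1}(1)},\dots,b_{\sigma^{-1}(k)})$;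 morphisms are levelwise continuous equivariant maps preserving $\gamma$ and $1$. It is a *covering* $\mathscr G$-operad if every point of every $\mathscr C(n)$ has a neighbourhood whose translates by distinct elements of $G_n$ are disjoint. Topological properties of $\mathscr C$ are meant for every $\mathscr C(n)$. Let $\mathscr C_1(k)$ be the space of $k$-tuples of nondegenerate closed subintervals of $[0,1]$ with pairwise disjoint interiors (the little intervals operad), let $c_k=([0,\frac1k],\dots,[\frac{k-1}k,1])$ and let $\mathscr C_1(k)_0$ be the path component of $c_k$; these form a nonsymmetric operad $(\mathscr C_1)_0$. A *good basepoint* of $\mathscr C$ is given by a morphism of nonsymmetric topological operads $\eta:(\mathscr C_1)_0\to\mathscr C$; put $e_k=\eta(c_k)$. The *linear path* $e_m\to\gamma(e_k;e_{m_1},\dots,e_{m_k})$, $m=m_1+\cdots+m_k$, is the image under $\eta$ of the linear path in $\mathscr C_1(m)_0$ from $c_m$ to $\gamma(c_k;c_{m_1},\dots,c_{m_k})$. **Theorem.** Let $\mathscr G$ be a group operad and $\mathscr C$ a path-connected, locally path-connected, semilocally simply-connected covering $\mathscr G$-operad with a good basepoint $\eta$. 1. For each $n$ let $\pi_1(\mathscr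 C(n);e_n,G_ne_n)$ be the set of pairs $(g,[f])$ with $g\in G_n$ and $[f]$ a homotopy class rel end points of paths from $e_n$ to $ge_n$, with product $(g,[f])(g',[f'])=(gg',[f\cdot gf'])$ and projection $\pi(g,[f])=g$. The quotient map $\mathscr C(n)\to\mathscr C(n)/G_n$ induces an isomorphism from this group to $\pi_1(\mathscr C(n)/G_n,G_ne_n)$ (with concatenation as product). These groups form a group operad $\pi_1(\mathscr C/\mathscr G)$, with structure maps to $S_n$ the composites of $\pi$ with $G_n\to S_n$, and with $\gamma((\sigma,[f]);(\tau_1,[g_1]),\dots,(\tau_k,[g_k]))$ equal to $\gamma(\sigma;\tau_1,\dots,\tau_k)$ together with the class of the concatenation of the linear path $e_m\to\gamma(e_k;e_{m_1},\dots,e_{m_k})$, the path $\gamma(f;g_1,\dots,g_k)$, and the translate by $\gamma(\sigma;\tau_1,\dots,\tau_k)$ of the reverse of the linear path $e_m\to\gamma(e_k;e_{m_{\sigma^{-1}(1)}},\dots,e_{m_{\sigma^{-1}(k)}})$. 2. Let $\widetilde{\mathscr C}(n)$ be the set of homotopy classes rel end points $[\alpha]$ of paths in $\mathscr C(n)$ starting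 at $e_n$, with its usual topology (generated by the sets $\{[\alpha\cdot\beta]:\beta \text{ a path in } U,\ \beta(0)=\alpha(1)\}$, $U$ open with $\alpha(1)\in U$), with projection $p[\alpha]=\alpha(1)$ and with action $(g,[f])\cdot[\alpha]=[f\cdot g\alpha]$ of $\pi_1(\mathscr C(n);e_n,G_ne_n)$. With unit the class of the constant path at $e_1$ and the composition $$\widetilde\gamma([\alpha];[\beta_1],\dots,[\beta_k])=[\,e_m\to\gamma(e_k;e_{m_1},\dots,e_{m_k})\xrightarrow{\gamma(\alpha;\beta_1,\dots,\beta_k)}\gamma(\alpha(1);\beta_1(1),\dots,\beta_k(1))\,],$$ whose first arrow is the linear path, $\widetilde{\mathscr C}$ is a covering $\pi_1(\mathscr C/\mathscr G)$-operad. Moreover $\widetilde\gamma$ is the unique continuous lifting of $\gamma\circ p$ through $p$ that takes $([e_k];[e_{m_1}],\dots,[e_{m_k}])$ to the class of the linear path $e_m\to\gamma(e_k;e_{m_1},\dots,e_{m_k})$. 3. $(\widetilde{\mathscr C},p)$ is a universal cover of $\mathscr C$: $\pi:\pi_1(\mathscr C/\mathscr G)\to\mathscr G$ is an epimorphism of group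 operads, $p$ is a morphism of $\pi_1(\mathscr C/\mathscr G)$-operads (where $\pi_1(\mathscr C/\mathscr G)$ acts on $\mathscr C$ through $\pi$), and each $p:\widetilde{\mathscr C}(n)\to\mathscr C(n)$ is a surjective covering map with simply connected total space. 4. Let $\pi_1\mathscr C(n)=\pi_1(\mathscr C(n),e_n)$ be the kernel of $\pi:\pi_1(\mathscr C(n);e_n,G_ne_n)\to G_n$. The structure of $\widetilde{\mathscr C}$ induces a $\mathscr G$-operad structure on the orbit spaces $\widetilde{\mathscr C}/\pi_1\mathscr C=\{\widetilde{\mathscr C}(n)/\pi_1\mathscr C(n)\}_{n\ge0}$ (the quotient maps preserve unit and composition and are equivariant along $\pi$), the projection $p$ factors through $\widetilde{\mathscr C}/\pi_1\mathscr C$, and the induced map $\widetilde{\mathscr C}/\pi_1\mathscr C\to\mathscr C$ is an isomorphism of $\mathscr G$-operads (equivariant, compatible with unit and composition, and a homeomorphism in each arity). -/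

import Mathlib

open scoped Topology

/-! ### Topological preliminaries -/

/-- Continuity on the compactly generated refinement (`k`-ification) of the domain.  For a map out
of a product of compactly generated Hausdorff spaces this is continuity for the product in the
category of compactly generated Hausdorff spaces. -/
def KContinuous {A B : Type*} [TopologicalSpace A] [TopologicalSpace B] (f : A → B) : Prop :=
  Continuous (f ∘ (CompactCoherentification.mk A).symm)

theorem KContinuous.comp_path {A B : Type*} [TopologicalSpace A] [TopologicalSpace B] {f : A → B}
    (hf : KContinuous f) {g : unitInterval → A} (hg : Continuous g) : Continuous (f ∘ g) := by
  have h : Continuous ((CompactCoherentification.mk A) ∘ g) :=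
    CompactCoherentification.continuous_rng_of_compactSpace.2 hg
  exact Continuous.comp (g := f ∘ (CompactCoherentification.mk A).symm) hf h

/-- Every point has a neighbourhood all of whose loops at that point are null-homotopic in the
whole space. -/
def SemilocallySimplyConnected (X : Type*) [TopologicalSpace X] : Prop :=
  ∀ x : X, ∃ U ∈ 𝓝 x, ∀ γ : Path x x, Set.range γ ⊆ U → γ.Homotopic (Path.refl x)

/-- A covering action of a discrete group (acting by homeomorphisms): every point has a
neighbourhood whose translates by distinct group elements are disjoint. -/
def IsCoveringAction (G X : Type*) [Group G] [TopologicalSpace X] [MulAction G X]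
    [ContinuousConstSMul G X] : Prop :=
  ∀ x : X, ∃ U ∈ 𝓝 x, ∀ g h : G,
    (((g • ·) '' U : Set X) ∩ ((h • ·) '' U)).Nonempty → g = h

namespace Path.Homotopic.Quotient

variable {X : Type*} [TopologicalSpace X]

theorem refl_cast {x y z : X} (h : y = x) (h' : z = x) :
    (refl x).cast h h' = (refl y).cast rfl (h'.trans h.symm) := by
  subst h; rfl

theorem trans_cast_right {x y z z' : X} (p : Path.Homotopic.Quotient x y)
    (q : Path.Homotopic.Quotient y z) (h : z' = z) :
    p.trans (q.cast rfl h) = (p.trans q).cast rfl h := by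
  subst h; simp

theorem cast_trans_cast {x x' y y' z z' : X} (p : Path.Homotopic.Quotient x y)
    (q : Path.Homotopic.Quotient y z) (hx : x' = x) (hy : y' = y) (hz : z' = z) :
    (p.cast hx hy).trans (q.cast hy hz) = (p.trans q).cast hx hz := by
  subst hx; subst hy; subst hz; simp

theorem map_trans {Y : Type*} [TopologicalSpace Y] {x y z : X} (p : Path.Homotopic.Quotient x y)
    (q : Path.Homotopic.Quotient y z) (f : C(X, Y)) :
    (p.trans q).map f = (p.map f).trans (q.map f) := by
  induction p with | mk p =>
  induction q with | mk q =>
  rw [← mk_trans, ← mk_map, Path.map_trans]; rfl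

variable {G : Type*} [Group G] [MulAction G X] [ContinuousConstSMul G X]

/-- Translate of a homotopy class of paths by a group element. -/
def translate {x y : X} (g : G) (p : Path.Homotopic.Quotient x y) :
    Path.Homotopic.Quotient (g • x) (g • y) :=
  p.map ⟨(g • ·), continuous_const_smul g⟩

theorem translate_trans {x y z : X} (g : G) (p : Path.Homotopic.Quotient x y)
    (q : Path.Homotopic.Quotient y z) :
    (p.trans q).translate g = (p.translate g).trans (q.translate g) := map_trans ..

theorem translate_cast {x y x' y' : X} (g : G) (p : Path.Homotopic.Quotient x y) (hx : x' = x)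
    (hy : y' = y) : (p.cast hx hy).translate g =
      (p.translate g).cast (by rw [hx]) (by rw [hy]) := by
  subst hx; subst hy; simp

theorem translate_mul {x y : X} (g h : G) (p : Path.Homotopic.Quotient x y) :
    p.translate (g * h) = ((p.translate h).translate g).cast (mul_smul ..) (mul_smul ..) := by
  induction p with | mk p =>
  refine congrArg mk ?_
  ext t
  exact mul_smul g h (p t)

theorem translate_one {x y : X} (p : Path.Homotopic.Quotient x y) :
    p.translate (1 : G) = p.cast (one_smul ..) (one_smul ..) := by
  induction p with | mk p =>
  refine congrArg mk ?_
  ext t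
  exact one_smul G (p t)

theorem translate_refl (g : G) (x : X) :
    (refl x).translate g = refl (g • x) := rfl

end Path.Homotopic.Quotient

/-! ### The universal cover of a pointed space -/

/-- Homotopy classes, relative to the end points, of paths starting at `e`. -/
def UnivCover (X : Type*) [TopologicalSpace X] (e : X) : Type _ :=
  Σ x : X, Path.Homotopic.Quotient e x

namespace UnivCover

variable {X : Type*} [TopologicalSpace X] {e : X}

/-- The class of a path. -/
def mk {x : X} (α : Path e x) : UnivCover X e := ⟨x, .mk α⟩

/-- The class of the constant path. -/
def base (e : X) : UnivCover X e := mk (Path.refl e)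

/-- The projection `[α] ↦ α(1)`. -/
def proj (a : UnivCover X e) : X := a.1

/-- The set `U_[α]` of classes `[α · η]` with `η` a path in `U` starting at `α(1)`. -/
def nhd (a : UnivCover X e) (U : Set X) : Set (UnivCover X e) :=
  {b | ∃ η : Path a.1 b.1, Set.range η ⊆ U ∧ b.2 = a.2.trans (.mk η)}

/-- The topology generated by the sets `U_[α]`, with `U` an open neighbourhood of `α(1)`. -/
instance : TopologicalSpace (UnivCover X e) :=
  TopologicalSpace.generateFrom {S | ∃ (a : UnivCover X e) (U : Set X),
    IsOpen U ∧ a.proj ∈ U ∧ S = a.nhd U}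

theorem ext {a b : UnivCover X e} (h : a.1 = b.1) (h' : a.2 = b.2.cast rfl h) : a = b := by
  obtain ⟨x, p⟩ := a
  obtain ⟨y, q⟩ := b
  dsimp only at h h'
  subst h
  rw [h', Path.Homotopic.Quotient.cast_rfl_rfl]

end UnivCover

/-! ### The fundamental group of an orbit space -/

/-- The set `π₁(X; e, Ge)`: pairs of a group element `g` and a homotopy class, relative to the end
points, of paths from `e` to `g • e`. -/
def OrbitPi1 (G X : Type*) [TopologicalSpace X] [Group G] [MulAction G X] (e : X) : Type _ :=
  Σ g : G, Path.Homotopic.Quotient e (g • e)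

namespace OrbitPi1

variable {G X : Type*} [TopologicalSpace X] [Group G] [MulAction G X] [ContinuousConstSMul G X]
  {e : X}

open Path.Homotopic.Quotient

/-- The class of a path from `e` to `g • e`. -/
def mk (g : G) (f : Path e (g • e)) : OrbitPi1 G X e := ⟨g, .mk f⟩

theorem ext {G X : Type*} [TopologicalSpace X] [Group G] [MulAction G X] {e : X}
    {a b : OrbitPi1 G X e} (h : a.1 = b.1)
    (h' : a.2 = b.2.cast rfl (by rw [h])) : a = b := by
  obtain ⟨x, p⟩ := a
  obtain ⟨y, q⟩ := b
  dsimp only at h h'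
  subst h
  rw [h', Path.Homotopic.Quotient.cast_rfl_rfl]

/-- The multiplication is `[f] * [f'] = [f · (g f')]` for `f` a path from `e` to `g • e`. -/
noncomputable instance : Group (OrbitPi1 G X e) where
  mul a b := ⟨a.1 * b.1, (a.2.trans (b.2.translate a.1)).cast rfl (mul_smul ..)⟩
  one := ⟨1, (Path.Homotopic.Quotient.refl e).cast rfl (one_smul ..)⟩
  inv a := ⟨a.1⁻¹, (a.2.symm.translate a.1⁻¹).cast (inv_smul_smul a.1 e).symm rfl⟩
  mul_assoc a b c := by
    refine ext (mul_assoc a.1 b.1 c.1) ?_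
    change (((a.2.trans (b.2.translate a.1)).cast rfl _).trans (c.2.translate (a.1 * b.1))).cast
      rfl _ = Path.Homotopic.Quotient.cast ((a.2.trans (Path.Homotopic.Quotient.translate a.1
        ((b.2.trans (c.2.translate b.1)).cast rfl _))).cast rfl _) _ _
    simp only [translate_cast, translate_trans, translate_mul, cast_trans_cast, trans_cast_right,
      trans_assoc, Path.Homotopic.Quotient.cast_cast]
  one_mul a := by
    refine ext (one_mul a.1) ?_
    change (((Path.Homotopic.Quotient.refl e).cast rfl _).trans (a.2.translate (1 : G))).cast rfl _ = _
    simp only [translate_one, cast_trans_cast, refl_trans, Path.Homotopic.Quotient.cast_cast]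
  mul_one a := by
    refine ext (mul_one a.1) ?_
    change (a.2.trans (Path.Homotopic.Quotient.translate a.1 ((Path.Homotopic.Quotient.refl e).cast rfl _))).cast rfl _ = _
    simp only [translate_cast, translate_refl, trans_cast_right, trans_refl, Path.Homotopic.Quotient.cast_cast]
  inv_mul_cancel a := by
    refine ext (inv_mul_cancel a.1) ?_
    change (((a.2.symm.translate a.1⁻¹).cast _ rfl).trans (a.2.translate a.1⁻¹)).cast rfl _ =
      Path.Homotopic.Quotient.cast ((Path.Homotopic.Quotient.refl e).cast rfl _) _ _
    have h := cast_trans_cast (a.2.symm.translate a.1⁻¹) (a.2.translate a.1⁻¹)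
      (inv_smul_smul a.1 e).symm rfl rfl
    rw [cast_rfl_rfl] at h
    rw [h, ← translate_trans, symm_trans, translate_refl, Path.Homotopic.Quotient.cast_cast, Path.Homotopic.Quotient.cast_cast]
    exact Path.Homotopic.Quotient.refl_cast _ _

/-- The homomorphism `π : π₁(X; e, Ge) → G`. -/
noncomputable def toGroup : OrbitPi1 G X e →* G where
  toFun a := a.1
  map_one' := rfl
  map_mul' _ _ := rfl

/-- The map `π₁(X; e, Ge) → π₁(X/G, Ge)` induced by the quotient map `X → X/G`; the target is the
set of homotopy classes of loops at the orbit of `e`. -/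
noncomputable def toLoop (a : OrbitPi1 G X e) :
    Path.Homotopic.Quotient (Quotient.mk (MulAction.orbitRel G X) e)
      (Quotient.mk (MulAction.orbitRel G X) e) :=
  (a.2.map ⟨Quotient.mk (MulAction.orbitRel G X), continuous_quotient_mk'⟩).cast rfl
    (Quotient.sound (MulAction.orbitRel_apply.2 (MulAction.mem_orbit_iff.2 ⟨a.1⁻¹, by simp⟩)))

/-- The action `[f] • [α] = [f · (g α)]` of `π₁(X; e, Ge)` on the universal cover, for `f` a path
from `e` to `g • e`. -/
noncomputable instance : MulAction (OrbitPi1 G X e) (UnivCover X e) where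
  smul a b := ⟨a.1 • b.1, a.2.trans (b.2.translate a.1)⟩
  one_smul b := by
    refine UnivCover.ext (one_smul G b.1) ?_
    change ((Path.Homotopic.Quotient.refl e).cast rfl _).trans (b.2.translate (1 : G)) = _
    simp only [translate_one, cast_trans_cast, refl_trans]
  mul_smul a b c := by
    refine UnivCover.ext (mul_smul a.1 b.1 c.1) ?_
    change ((a.2.trans (b.2.translate a.1)).cast rfl _).trans (c.2.translate (a.1 * b.1)) =
      (a.2.trans (Path.Homotopic.Quotient.translate a.1 (b.2.trans (c.2.translate b.1)))).cast rfl _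
    simp only [translate_trans, translate_mul, cast_trans_cast, trans_assoc]

theorem smul_mem_nhd (a : OrbitPi1 G X e) {b c : UnivCover X e} {U V : Set X}
    (hUV : ∀ x ∈ U, a.1 • x ∈ V) (h : c ∈ b.nhd U) : a • c ∈ (a • b).nhd V := by
  obtain ⟨η, hη, hc⟩ := h
  refine ⟨η.map (continuous_const_smul a.1), ?_, ?_⟩
  · rintro _ ⟨t, rfl⟩
    exact hUV _ (hη ⟨t, rfl⟩)
  · change a.2.trans (c.2.translate a.1) = (a.2.trans (b.2.translate a.1)).trans _
    rw [hc, translate_trans, trans_assoc]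
    rfl

instance : ContinuousConstSMul (OrbitPi1 G X e) (UnivCover X e) where
  continuous_const_smul a := by
    refine continuous_generateFrom_iff.2 ?_
    rintro _ ⟨b, U, hU, hb, rfl⟩
    refine TopologicalSpace.isOpen_generateFrom_of_mem
      ⟨a⁻¹ • b, (a.1 • ·) ⁻¹' U, hU.preimage (continuous_const_smul a.1), ?_, ?_⟩
    · change a.1 • a.1⁻¹ • b.proj ∈ U
      rwa [smul_inv_smul]
    · ext c
      constructor
      · intro h
        have := smul_mem_nhd a⁻¹ (V := (a.1 • ·) ⁻¹' U) (fun x hx ↦ by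
          change a.1 • a.1⁻¹ • x ∈ U
          rwa [smul_inv_smul]) h
        rwa [inv_smul_smul] at this
      · intro h
        have := smul_mem_nhd a (V := U) (fun x hx ↦ hx) h
        rwa [smul_inv_smul] at this

/-- The kernel of `π : π₁(X; e, Ge) → G`, that is, `π₁(X, e)`. -/
noncomputable abbrev pi1 (G X : Type*) [TopologicalSpace X] [Group G] [MulAction G X]
    [ContinuousConstSMul G X] (e : X) : Subgroup (OrbitPi1 G X e) :=
  (toGroup : OrbitPi1 G X e →* G).ker

end OrbitPi1

/-- The orbit space of the universal cover of `(X, e)` under `π₁(X, e)`. -/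
abbrev UnivCover.ModPi1 (G X : Type*) [TopologicalSpace X] [Group G] [MulAction G X]
    [ContinuousConstSMul G X] (e : X) : Type _ :=
  MulAction.orbitRel.Quotient (OrbitPi1.pi1 G X e) (UnivCover X e)

/-! ### Operads -/

/-- Positions in a concatenation of `k` blocks of lengths `m 0, …, m (k - 1)`, in the
lexicographic order. -/
def blockEquiv {k n : ℕ} (m : Fin k → ℕ) (h : ∑ i, m i = n) : (Σ i, Fin (m i)) ≃ Fin n :=
  finSigmaFinEquiv.trans (finCongr h)

theorem sum_perm {k n : ℕ} {m : Fin k → ℕ} (h : ∑ i, m i = n) (s : Equiv.Perm (Fin k)) :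
    ∑ i, m (s.symm i) = n :=
  (Equiv.sum_comp s.symm m).trans h

/-- An operad of sets with a single operation of arity zero: `comp` is the composition
`γ(a; b₁, …, b_k)`, with target indexed by any `n` equal to `m₁ + ⋯ + m_k`. -/
structure Operad (X : ℕ → Type*) where
  one : X 1
  comp : ∀ {k n : ℕ} (m : Fin k → ℕ) (_ : ∑ i, m i = n), X k → (∀ i, X (m i)) → X n
  unique_zero : Nonempty (Unique (X 0))
  assoc : ∀ {k N n : ℕ} (m : Fin k → ℕ) (h : ∑ i, m i = N) (l : Fin N → ℕ) (h₁ : ∑ j, l j = n)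
    (h₂ : ∑ i, ∑ x, l (blockEquiv m h ⟨i, x⟩) = n) (a : X k) (b : ∀ i, X (m i))
    (c : ∀ j, X (l j)),
    comp l h₁ (comp m h a b) c =
      comp (fun i ↦ ∑ x, l (blockEquiv m h ⟨i, x⟩)) h₂ a
        (fun i ↦ comp (fun x ↦ l (blockEquiv m h ⟨i, x⟩)) rfl (b i)
          (fun x ↦ c (blockEquiv m h ⟨i, x⟩)))
  one_comp : ∀ {n : ℕ} (a : X n), comp (fun _ : Fin 1 ↦ n) (by simp) one (fun _ ↦ a) = a
  comp_one : ∀ {n : ℕ} (a : X n), comp (fun _ : Fin n ↦ 1) (by simp) a (fun _ ↦ one) = a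

/-- A topological operad: an operad in compactly generated Hausdorff spaces. -/
structure TopOperad (X : ℕ → Type*) [∀ n, TopologicalSpace (X n)] extends Operad X where
  t2 : ∀ n, T2Space (X n)
  compactlyGenerated : ∀ n, CompactlyCoherentSpace (X n)
  continuous_comp : ∀ {k n : ℕ} (m : Fin k → ℕ) (h : ∑ i, m i = n),
    KContinuous fun p : X k × (∀ i, X (m i)) ↦ comp m h p.1 p.2

/-- The path `t ↦ γ(α(t); β₁(t), …, β_k(t))`. -/
def TopOperad.compPath {X : ℕ → Type*} [∀ n, TopologicalSpace (X n)] (C : TopOperad X) {k n : ℕ}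
    (m : Fin k → ℕ) (h : ∑ i, m i = n) {a a' : X k} {b b' : ∀ i, X (m i)} (α : Path a a')
    (β : ∀ i, Path (b i) (b' i)) : Path (C.comp m h a b) (C.comp m h a' b') where
  toFun t := C.comp m h (α t) (fun i ↦ β i t)
  continuous_toFun := (C.continuous_comp m h).comp_path (g := fun t ↦ (α t, fun i ↦ β i t))
    (α.continuous.prodMk (continuous_pi fun i ↦ (β i).continuous))
  source' := by simp
  target' := by simp

/-- Composition in the operad of symmetric groups: `τ i` permutes the `i`-th block, which is then
moved to the position `σ i`. -/
def symComp {k n : ℕ} (m : Fin k → ℕ) (h : ∑ i, m i = n) (σ : Equiv.Perm (Fin k))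
    (τ : ∀ i, Equiv.Perm (Fin (m i))) : Equiv.Perm (Fin n) :=
  (blockEquiv m h).symm.trans
    ((Equiv.sigmaCongr σ (β₂ := fun j ↦ Fin (m (σ.symm j)))
      (fun i ↦ (τ i).trans (finCongr (by simp)))).trans
        (blockEquiv (fun j ↦ m (σ.symm j)) (sum_perm h σ)))

/-- A group operad.  The structure map `π` to the symmetric groups is `perm`; as in `perm_mul`, a
product in the symmetric groups acts by its left factor first. -/
structure GroupOperad (G : ℕ → Type*) [∀ n, Group (G n)] extends Operad G where
  perm : ∀ {n : ℕ}, G n → Equiv.Perm (Fin n)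
  perm_mul : ∀ {n : ℕ} (a b : G n), perm (a * b) = (perm a).trans (perm b)
  perm_comp : ∀ {k n : ℕ} (m : Fin k → ℕ) (h : ∑ i, m i = n) (a : G k) (b : ∀ i, G (m i)),
    perm (comp m h a b) = symComp m h (perm a) (fun i ↦ perm (b i))
  one_eq : one = 1
  comp_mul : ∀ {k n : ℕ} (m : Fin k → ℕ) (h : ∑ i, m i = n) (a a' : G k) (b b' : ∀ i, G (m i)),
    comp m h (a * a') (fun i ↦ b i * b' i) =
      comp m h a b * comp (fun i ↦ m ((perm a).symm i)) (sum_perm h (perm a)) a'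
        (fun i ↦ b' ((perm a).symm i))

/-- A morphism of group operads. -/
structure GroupOperad.IsHom {G' G : ℕ → Type*} [∀ n, Group (G' n)] [∀ n, Group (G n)]
    (𝒢' : GroupOperad G') (𝒢 : GroupOperad G) (φ : ∀ n, G' n →* G n) : Prop where
  perm : ∀ {n : ℕ} (a : G' n), 𝒢.perm (φ n a) = 𝒢'.perm a
  comp : ∀ {k n : ℕ} (m : Fin k → ℕ) (h : ∑ i, m i = n) (a : G' k) (b : ∀ i, G' (m i)),
    φ n (𝒢'.comp m h a b) = 𝒢.comp m h (φ k a) (fun i ↦ φ (m i) (b i))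

/-- A topological `𝒢`-operad: the groups `G n` act from the left by homeomorphisms, and the
composition is equivariant. -/
structure GOperad {G : ℕ → Type*} [∀ n, Group (G n)] (𝒢 : GroupOperad G) (X : ℕ → Type*)
    [∀ n, TopologicalSpace (X n)] [∀ n, MulAction (G n) (X n)]
    [∀ n, ContinuousConstSMul (G n) (X n)] extends TopOperad X where
  smul_comp_smul : ∀ {k n : ℕ} (m : Fin k → ℕ) (h : ∑ i, m i = n) (σ : G k) (τ : ∀ i, G (m i))
    (a : X k) (b : ∀ i, X (m i)),
    comp m h (σ • a) (fun i ↦ τ i • b i) =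
      𝒢.comp m h σ τ • comp (fun i ↦ m ((𝒢.perm σ).symm i)) (sum_perm h (𝒢.perm σ)) a
        (fun i ↦ b ((𝒢.perm σ).symm i))

namespace GOperad

variable {G' G : ℕ → Type*} [∀ n, Group (G' n)] [∀ n, Group (G n)] {𝒢' : GroupOperad G'}
  {𝒢 : GroupOperad G} {X' X : ℕ → Type*} [∀ n, TopologicalSpace (X' n)]
  [∀ n, TopologicalSpace (X n)] [∀ n, MulAction (G' n) (X' n)] [∀ n, MulAction (G n) (X n)]
  [∀ n, ContinuousConstSMul (G' n) (X' n)] [∀ n, ContinuousConstSMul (G n) (X n)]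

/-- A covering `𝒢`-operad. -/
def IsCovering (_ : GOperad 𝒢 X) : Prop :=
  ∀ n, IsCoveringAction (G n) (X n)

/-- `ψ` is a morphism of `𝒢'`-operads from `C'` to `C`, the `𝒢`-operad `C` being regarded as a
`𝒢'`-operad via `φ : 𝒢' → 𝒢`. -/
structure IsHomAlong (φ : ∀ n, G' n →* G n) (C' : GOperad 𝒢' X') (C : GOperad 𝒢 X)
    (ψ : ∀ n, X' n → X n) : Prop where
  continuous : ∀ n, Continuous (ψ n)
  map_smul : ∀ {n : ℕ} (g : G' n) (a : X' n), ψ n (g • a) = φ n g • ψ n a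
  map_one : ψ 1 C'.one = C.one
  map_comp : ∀ {k n : ℕ} (m : Fin k → ℕ) (h : ∑ i, m i = n) (a : X' k) (b : ∀ i, X' (m i)),
    ψ n (C'.comp m h a b) = C.comp m h (ψ k a) (fun i ↦ ψ (m i) (b i))

/-- An isomorphism of `𝒢`-operads. -/
def IsIso (C' : GOperad 𝒢 X) {Y : ℕ → Type*} [∀ n, TopologicalSpace (Y n)]
    [∀ n, MulAction (G n) (Y n)] [∀ n, ContinuousConstSMul (G n) (Y n)] (C : GOperad 𝒢 Y)
    (ψ : ∀ n, X n → Y n) : Prop :=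
  IsHomAlong (fun n ↦ MonoidHom.id (G n)) C' C ψ ∧ ∀ n, IsHomeomorph (ψ n)

/-- `(C', ψ)` is a universal cover of the `𝒢`-operad `C`: `φ : 𝒢' → 𝒢` is an epimorphism of group
operads, `ψ` is a morphism of `𝒢'`-operads, and `ψ` is a universal covering in each arity. -/
structure IsUniversalCover (φ : ∀ n, G' n →* G n) (C' : GOperad 𝒢' X') (C : GOperad 𝒢 X)
    (ψ : ∀ n, X' n → X n) : Prop where
  isHom_group : GroupOperad.IsHom 𝒢' 𝒢 φ
  surjective_group : ∀ n, Function.Surjective (φ n)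
  isHom : IsHomAlong φ C' C ψ
  isCoveringMap : ∀ n, IsCoveringMap (ψ n)
  surjective : ∀ n, Function.Surjective (ψ n)
  simplyConnected : ∀ n, SimplyConnectedSpace (X' n)

end GOperad

/-! ### Little intervals and good basepoints -/

/-- The space of `k`-tuples of nondegenerate closed subintervals of `[0, 1]` with pairwise disjoint
interiors, an interval being given by its pair of end points. -/
abbrev LittleIntervals (k : ℕ) : Type :=
  {c : Fin k → ℝ × ℝ // (∀ i, 0 ≤ (c i).1 ∧ (c i).1 < (c i).2 ∧ (c i).2 ≤ 1) ∧
    ∀ i j, i ≠ j → Disjoint (Set.Ioo (c i).1 (c i).2) (Set.Ioo (c j).1 (c j).2)}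

namespace LittleIntervals

/-- The intervals are arranged from left to right. -/
def Ordered {k : ℕ} (c : Fin k → ℝ × ℝ) : Prop :=
  (∀ i, 0 ≤ (c i).1 ∧ (c i).1 < (c i).2 ∧ (c i).2 ≤ 1) ∧ ∀ i j, i < j → (c i).2 ≤ (c j).1

theorem Ordered.disjoint {k : ℕ} {c : Fin k → ℝ × ℝ} (hc : Ordered c) (i j : Fin k) (h : i ≠ j) :
    Disjoint (Set.Ioo (c i).1 (c i).2) (Set.Ioo (c j).1 (c j).2) := by
  rw [Set.disjoint_left]
  intro x hx hx'
  rcases lt_or_gt_of_ne h with h | h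
  · linarith [hc.2 i j h, hx.2, hx'.1]
  · linarith [hc.2 j i h, hx.1, hx'.2]

/-- A tuple of intervals arranged from left to right. -/
def ofOrdered {k : ℕ} {c : Fin k → ℝ × ℝ} (hc : Ordered c) : LittleIntervals k :=
  ⟨c, hc.1, hc.disjoint⟩

theorem ordered_std (k : ℕ) : Ordered fun i : Fin k ↦ ((i : ℝ) / k, ((i : ℝ) + 1) / k) := by
  refine ⟨fun i ↦ ?_, fun i j h ↦ ?_⟩
  · have hk : (0 : ℝ) < k := by exact_mod_cast i.pos
    have hi : (i : ℝ) + 1 ≤ k := by exact_mod_cast i.2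
    refine ⟨by positivity, ?_, ?_⟩
    · exact div_lt_div_of_pos_right (by linarith) hk
    · exact (div_le_one hk).2 hi
  · have hi : (i : ℝ) + 1 ≤ j := by exact_mod_cast h
    exact div_le_div_of_nonneg_right hi (by positivity)

/-- The configuration `c_k = ([0, 1/k], [1/k, 2/k], …, [(k-1)/k, 1])`. -/
noncomputable def std (k : ℕ) : LittleIntervals k := ofOrdered (ordered_std k)

theorem ordered_combo {k : ℕ} {c c' : Fin k → ℝ × ℝ} (hc : Ordered c) (hc' : Ordered c') (t : unitInterval) :
    Ordered ((1 - (t : ℝ)) • c + (t : ℝ) • c') := by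
  have ht := t.2.1
  have ht' : (0 : ℝ) ≤ 1 - t := by linarith [t.2.2]
  refine ⟨fun i ↦ ?_, fun i j h ↦ ?_⟩
  · obtain ⟨h1, h2, h3⟩ := hc.1 i
    obtain ⟨h1', h2', h3'⟩ := hc'.1 i
    simp only [Pi.add_apply, Pi.smul_apply, Prod.fst_add, Prod.snd_add, Prod.smul_fst,
      Prod.smul_snd, smul_eq_mul]
    refine ⟨by positivity, ?_, by nlinarith⟩
    rcases eq_or_lt_of_le ht with h | h
    · rw [← h]; linarith
    · nlinarith
  · have := hc.2 i j h
    have := hc'.2 i j h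
    simp only [Pi.add_apply, Pi.smul_apply, Prod.fst_add, Prod.snd_add, Prod.smul_fst,
      Prod.smul_snd, smul_eq_mul]
    nlinarith

/-- The linear path between two configurations arranged from left to right. -/
def linearPathOfOrdered {k : ℕ} (c c' : LittleIntervals k) (hc : Ordered c.1)
    (hc' : Ordered c'.1) : Path c c' where
  toFun t := ofOrdered (ordered_combo hc hc' t)
  continuous_toFun := by
    refine Continuous.subtype_mk ?_ _
    fun_prop
  source' := Subtype.ext (by simp [ofOrdered])
  target' := Subtype.ext (by simp [ofOrdered])

/-- The path component of `c_k` consists of the configurations arranged from left to right. -/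
theorem mem_pathComponent_std {k : ℕ} (c : LittleIntervals k) :
    c ∈ pathComponent (std k) ↔ Ordered c.1 := by
  refine ⟨fun ⟨p⟩ ↦ ⟨c.2.1, fun i j hij ↦ ?_⟩, fun h ↦
    ⟨linearPathOfOrdered _ _ (ordered_std k) h⟩⟩
  have key : ∀ d : LittleIntervals k, (d.1 i).1 ≠ (d.1 j).1 := by
    intro d hd
    have hi := (d.2.1 i).2.1
    have hj := (d.2.1 j).2.1
    obtain ⟨x, hx, hx'⟩ := exists_between (lt_min hi (hd ▸ hj))
    exact Set.disjoint_left.1 (d.2.2 i j hij.ne) ⟨hx, hx'.trans_le (min_le_left _ _)⟩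
      ⟨hd ▸ hx, hx'.trans_le (min_le_right _ _)⟩
  have hlt : (c.1 i).1 < (c.1 j).1 := by
    by_contra hcon
    have hcont : Continuous fun t : unitInterval ↦ ((p t).1 j).1 - ((p t).1 i).1 :=
      ((continuous_apply j).comp (continuous_subtype_val.comp p.continuous)).fst.sub
        ((continuous_apply i).comp (continuous_subtype_val.comp p.continuous)).fst
    have h0 : 0 ≤ ((p 0).1 j).1 - ((p 0).1 i).1 := by
      have := (ordered_std k).2 i j hij
      have := ((ordered_std k).1 i).2.1
      rw [p.source]
      simp only [std, ofOrdered]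
      linarith
    have h1 : ((p 1).1 j).1 - ((p 1).1 i).1 ≤ 0 := by
      rw [p.target]; linarith
    obtain ⟨t, ht⟩ := mem_range_of_exists_le_of_exists_ge hcont ⟨1, h1⟩ ⟨0, h0⟩
    exact key (p t) (by linarith)
  by_contra hcon
  push Not at hcon
  obtain ⟨x, hx, hx'⟩ := exists_between (lt_min hcon (c.2.1 j).2.1)
  exact Set.disjoint_left.1 (c.2.2 i j hij.ne)
    ⟨hlt.trans hx, hx'.trans_le (min_le_left _ _)⟩ ⟨hx, hx'.trans_le (min_le_right _ _)⟩

end LittleIntervals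

/-- The path component of `c_k` in the space of `k`-tuples of little intervals. -/
abbrev LittleIntervals₀ (k : ℕ) : Type :=
  {c : LittleIntervals k // c ∈ pathComponent (LittleIntervals.std k)}

namespace LittleIntervals₀

open LittleIntervals

/-- The element `c_k`. -/
noncomputable def std (k : ℕ) : LittleIntervals₀ k :=
  ⟨LittleIntervals.std k, mem_pathComponent_self _⟩

theorem ordered {k : ℕ} (c : LittleIntervals₀ k) : Ordered c.1.1 :=
  (mem_pathComponent_std c.1).1 c.2

/-- A tuple of intervals arranged from left to right, as a point of the path component. -/
def ofOrdered {k : ℕ} {c : Fin k → ℝ × ℝ} (hc : Ordered c) : LittleIntervals₀ k :=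
  ⟨LittleIntervals.ofOrdered hc, (mem_pathComponent_std _).2 hc⟩

/-- The linear path `t ↦ (1 - t) c + t c'`. -/
def linearPath {k : ℕ} (c c' : LittleIntervals₀ k) : Path c c' where
  toFun t := ofOrdered (ordered_combo c.ordered c'.ordered t)
  continuous_toFun := by
    refine Continuous.subtype_mk (Continuous.subtype_mk ?_ _) _
    fun_prop
  source' := Subtype.ext (Subtype.ext (by simp [ofOrdered, LittleIntervals.ofOrdered]))
  target' := Subtype.ext (Subtype.ext (by simp [ofOrdered, LittleIntervals.ofOrdered]))

/-- The images of the intervals `b i x` under the increasing affine maps from `[0, 1]` onto the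
intervals `a i`, in the lexicographic order. -/
def compFun {k n : ℕ} (m : Fin k → ℕ) (h : ∑ i, m i = n) (a : Fin k → ℝ × ℝ)
    (b : ∀ i, Fin (m i) → ℝ × ℝ) (j : Fin n) : ℝ × ℝ :=
  let p := (blockEquiv m h).symm j
  ((a p.1).1 + ((a p.1).2 - (a p.1).1) * (b p.1 p.2).1,
    (a p.1).1 + ((a p.1).2 - (a p.1).1) * (b p.1 p.2).2)

theorem lex_of_lt {k n : ℕ} (m : Fin k → ℕ) (h : ∑ i, m i = n) (p q : Σ i, Fin (m i))
    (hpq : blockEquiv m h p < blockEquiv m h q) :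
    p.1 < q.1 ∨ ∃ e : p.1 = q.1, Fin.cast (congrArg m e) p.2 < q.2 := by
  have hval : ∀ r : Σ i, Fin (m i), (blockEquiv m h r : ℕ) =
      ∑ i ∈ Finset.univ.filter (· < r.1), m i + r.2 := by
    intro r
    change (finSigmaFinEquiv r : ℕ) = _
    rw [finSigmaFinEquiv_apply]
    congr 1
    refine Finset.sum_bij (fun i _ ↦ Fin.castLE r.1.2.le i) ?_ ?_ ?_ ?_
    · intro i _
      exact Finset.mem_filter.2 ⟨Finset.mem_univ _, i.2⟩
    · intro i _ i' _ e
      exact Fin.castLE_injective _ e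
    · intro i hi
      exact ⟨⟨i, (Finset.mem_filter.1 hi).2⟩, Finset.mem_univ _, rfl⟩
    · intro i _
      rfl
  rw [Fin.lt_def, hval, hval] at hpq
  rcases lt_trichotomy p.1 q.1 with hlt | heq | hgt
  · exact Or.inl hlt
  · refine Or.inr ⟨heq, ?_⟩
    have hS : ∑ i ∈ Finset.univ.filter (· < p.1), m i =
        ∑ i ∈ Finset.univ.filter (· < q.1), m i := by rw [heq]
    rw [Fin.lt_def, Fin.val_cast]
    omega
  · exfalso
    have hsub : insert q.1 (Finset.univ.filter (· < q.1)) ⊆ Finset.univ.filter (· < p.1) := by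
      intro i hi
      rcases Finset.mem_insert.1 hi with rfl | hi
      · simpa using hgt
      · have := (Finset.mem_filter.1 hi).2
        simpa using this.trans hgt
    have hle := Finset.sum_le_sum_of_subset (f := m) hsub
    rw [Finset.sum_insert (by simp)] at hle
    have := q.2.2
    omega

theorem ordered_comp {k n : ℕ} (m : Fin k → ℕ) (h : ∑ i, m i = n) {a : Fin k → ℝ × ℝ}
    {b : ∀ i, Fin (m i) → ℝ × ℝ} (ha : Ordered a) (hb : ∀ i, Ordered (b i)) :
    Ordered (compFun m h a b) := by
  refine ⟨fun j ↦ ?_, fun j j' hj ↦ ?_⟩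
  · simp only [compFun]
    generalize (blockEquiv m h).symm j = p
    obtain ⟨h1, h2, h3⟩ := ha.1 p.1
    obtain ⟨h1', h2', h3'⟩ := (hb p.1).1 p.2
    exact ⟨by nlinarith, by nlinarith, by nlinarith⟩
  · have hlex := lex_of_lt m h ((blockEquiv m h).symm j) ((blockEquiv m h).symm j') (by simpa)
    simp only [compFun]
    generalize (blockEquiv m h).symm j = p at *
    generalize (blockEquiv m h).symm j' = q at *
    obtain ⟨h1, h2, h3⟩ := ha.1 p.1
    obtain ⟨h1', h2', h3'⟩ := (hb p.1).1 p.2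
    obtain ⟨k1, k2, k3⟩ := ha.1 q.1
    obtain ⟨k1', k2', k3'⟩ := (hb q.1).1 q.2
    rcases hlex with hlt | ⟨e, hlt⟩
    · have := ha.2 _ _ hlt
      nlinarith
    · obtain ⟨i, x⟩ := p
      obtain ⟨i', y⟩ := q
      dsimp only at e hlt
      subst e
      have := (hb i).2 x y hlt
      dsimp only at *
      nlinarith

/-- The composition of the nonsymmetric operad of path components of the `c_k`. -/
def comp {k n : ℕ} (m : Fin k → ℕ) (h : ∑ i, m i = n) (a : LittleIntervals₀ k)
    (b : ∀ i, LittleIntervals₀ (m i)) : LittleIntervals₀ n :=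
  ofOrdered (ordered_comp m h a.ordered fun i ↦ (b i).ordered)

end LittleIntervals₀

/-- A good basepoint of a topological operad: a morphism `η` of nonsymmetric topological operads
from the path components of the configurations `c_k`, whose unit is `c_1 = [0, 1]`. -/
structure GoodBasepoint {X : ℕ → Type*} [∀ n, TopologicalSpace (X n)] (C : TopOperad X) where
  η : ∀ n, LittleIntervals₀ n → X n
  continuous : ∀ n, Continuous (η n)
  map_one : η 1 (LittleIntervals₀.std 1) = C.one
  map_comp : ∀ {k n : ℕ} (m : Fin k → ℕ) (h : ∑ i, m i = n) (a : LittleIntervals₀ k)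
    (b : ∀ i, LittleIntervals₀ (m i)),
    η n (LittleIntervals₀.comp m h a b) = C.comp m h (η k a) (fun i ↦ η (m i) (b i))

namespace GoodBasepoint

variable {X : ℕ → Type*} [∀ n, TopologicalSpace (X n)] {C : TopOperad X}

/-- The basepoint `e_n = η(c_n)`. -/
noncomputable def pt (η : GoodBasepoint C) (n : ℕ) : X n := η.η n (LittleIntervals₀.std n)

/-- The linear path from `e_n` to `γ(e_k; e_{m₁}, …, e_{m_k})`. -/
noncomputable def linear (η : GoodBasepoint C) {k n : ℕ} (m : Fin k → ℕ) (h : ∑ i, m i = n) :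
    Path (η.pt n) (C.comp m h (η.pt k) (fun i ↦ η.pt (m i))) :=
  ((LittleIntervals₀.linearPath (LittleIntervals₀.std n) (LittleIntervals₀.comp m h
    (LittleIntervals₀.std k) (fun i ↦ LittleIntervals₀.std (m i)))).map (η.continuous n)).cast rfl
      (η.map_comp m h _ _).symm

end GoodBasepoint

/-! ### The fundamental groups operad and the universal cover of an operad -/

section Main

variable {G : ℕ → Type*} [∀ n, Group (G n)] {𝒢 : GroupOperad G} {X : ℕ → Type*}
  [∀ n, TopologicalSpace (X n)] [∀ n, MulAction (G n) (X n)]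
  [∀ n, ContinuousConstSMul (G n) (X n)]

/-- The path representing `γ([f]; [g₁], …, [g_k])`, for `f` a path from `e_k` to `σ e_k` and `g_i`
a path from `e_{m_i}` to `τ_i e_{m_i}`: the concatenation of the linear path
`e_n → γ(e_k; e_{m₁}, …)`, the path `γ(f; g₁, …)`, which ends at
`γ(σ; τ₁, …) γ(e_k; e_{m_{σ⁻¹(1)}}, …)`, and the translate by `γ(σ; τ₁, …)` of the reverse of the
linear path `e_n → γ(e_k; e_{m_{σ⁻¹(1)}}, …)`. -/
noncomputable def GOperad.pi1Path (C : GOperad 𝒢 X) (η : GoodBasepoint C.toTopOperad) {k n : ℕ}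
    (m : Fin k → ℕ) (h : ∑ i, m i = n) {s : G k} {t : ∀ i, G (m i)}
    (f : Path (η.pt k) (s • η.pt k)) (g : ∀ i, Path (η.pt (m i)) (t i • η.pt (m i))) :
    Path (η.pt n) (𝒢.comp m h s t • η.pt n) :=
  ((η.linear m h).trans
    ((C.compPath m h f g).cast rfl (C.smul_comp_smul m h s t _ _).symm)).trans
      ((η.linear (fun i ↦ m ((𝒢.perm s).symm i)) (sum_perm h (𝒢.perm s))).symm.map
        (continuous_const_smul (𝒢.comp m h s t)))

/-- `P` is the fundamental groups operad `π₁(C/𝒢)`, whose groups are `π₁(C(n); e_n, G_n e_n)`. -/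
structure GOperad.IsFundamentalGroupOperad (C : GOperad 𝒢 X) (η : GoodBasepoint C.toTopOperad)
    (P : GroupOperad fun n ↦ OrbitPi1 (G n) (X n) (η.pt n)) : Prop where
  perm : ∀ {n : ℕ} (f : OrbitPi1 (G n) (X n) (η.pt n)), P.perm f = 𝒢.perm f.toGroup
  comp : ∀ {k n : ℕ} (m : Fin k → ℕ) (h : ∑ i, m i = n) (s : G k) (t : ∀ i, G (m i))
    (f : Path (η.pt k) (s • η.pt k)) (g : ∀ i, Path (η.pt (m i)) (t i • η.pt (m i))),
    P.comp m h (.mk s f) (fun i ↦ .mk (t i) (g i)) = .mk (𝒢.comp m h s t) (C.pi1Path η m h f g)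

/-- `U` is the operad of the universal covers of the pointed spaces `(C(n), e_n)`, with composition
`γ̃([α]; [β₁], …, [β_k]) = [e_n → γ(e_k; e_{m₁}, …) → γ(α(1); β₁(1), …)]`, where the two paths are
the linear one and `γ(α; β₁, …)`. -/
structure GOperad.IsUnivCoverOperad (C : GOperad 𝒢 X) (η : GoodBasepoint C.toTopOperad)
    {P : GroupOperad fun n ↦ OrbitPi1 (G n) (X n) (η.pt n)}
    (U : GOperad P fun n ↦ UnivCover (X n) (η.pt n)) : Prop where
  one : U.one = .base (η.pt 1)
  comp : ∀ {k n : ℕ} (m : Fin k → ℕ) (h : ∑ i, m i = n) {x : X k} {y : ∀ i, X (m i)}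
    (α : Path (η.pt k) x) (β : ∀ i, Path (η.pt (m i)) (y i)),
    U.comp m h (.mk α) (fun i ↦ .mk (β i)) = .mk ((η.linear m h).trans (C.compPath m h α β))

/-- `f` is a lifting of `γ ∘ p` through `p`, continuous on the product of compactly generated
spaces, with value the class of the linear path `e_n → γ(e_k; e_{m₁}, …)` at the basepoint. -/
structure GOperad.IsLift (C : GOperad 𝒢 X) (η : GoodBasepoint C.toTopOperad) {k n : ℕ}
    (m : Fin k → ℕ) (h : ∑ i, m i = n)
    (f : UnivCover (X k) (η.pt k) → (∀ i, UnivCover (X (m i)) (η.pt (m i))) →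
      UnivCover (X n) (η.pt n)) : Prop where
  continuous : KContinuous fun p : UnivCover (X k) (η.pt k) ×
    (∀ i, UnivCover (X (m i)) (η.pt (m i))) ↦ f p.1 p.2
  proj : ∀ a b, (f a b).proj = C.comp m h a.proj (fun i ↦ (b i).proj)
  base : f (.base _) (fun _ ↦ .base _) = .mk (η.linear m h)

end Main

/-!
Two continuous lifts through a covering that agree at one point agree on a path-connected space,
and on a simply connected, locally path-connected space lifts exist. Since `γ` is only continuous on
the compactly generated product, lifting is done for maps that are continuous on compact Hausdorff
test spaces.

Lifting `γ ∘ p` through `p : C̃(n) → C(n)` with the class of the linear path as the value at the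
basepoint gives `γ̃`. Associativity and the unit laws hold because both sides lift the same map and
agree at the basepoints: since the components `C₁(n)₀` of the little intervals are contractible, `η`
gives a well-defined map `c ↦ [η(c_n → c)]` to `C̃(n)`, which respects compositions and has the
basepoint as its value at `c_n`.

For every `g ∈ G_n` and `a, b ∈ C̃(n)` with `p(b) = g p(a)` there is exactly one element of
`π₁(C(n); e_n, G_n e_n)` over `g` taking `a` to `b`. Hence there is only one possible composition on
these groups making `γ̃` equivariant at the basepoints. Uniqueness of lifts gives equivariance
everywhere, and the axioms of a group operad follow from those of `C̃` by comparing the action of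
both sides on a basepoint. Finally `p` is the quotient map of `C̃(n)` by the elements over `1`, so
that `C̃(n) / π₁C(n) ≅ C(n)`.
-/

/-! ### Compactly generated spaces -/

section CompactlyGenerated

open CompactCoherentification Topology

variable {A B Y : Type*} [TopologicalSpace A] [TopologicalSpace B] [TopologicalSpace Y]

theorem isOpen_compactCoherentification_iff {S : Set Y} :
    IsOpen ((CompactCoherentification.mk Y).symm ⁻¹' S) ↔
      ∀ K : Set Y, IsCompact K → ∀ y ∈ K, y ∈ S → S ∈ 𝓝[K] y := by
  have h_nhds (K : Set Y) (y : K) : Subtype.val ⁻¹' S ∈ 𝓝 y ↔ S ∈ 𝓝[K] (y : Y) :=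
    preimage_coe_mem_nhds_subtype
  rw [CompactCoherentification.isOpen_iff]
  refine forall₂_congr fun K _ ↦ ?_
  rw [isOpen_iff_mem_nhds, Subtype.forall]
  exact forall₂_congr fun y hy ↦ imp_congr_right fun _ ↦ h_nhds K ⟨y, hy⟩

theorem exists_isCompact_subset_mem_nhdsWithin [T2Space Y] {K O : Set Y} (hK : IsCompact K) {y : Y}
    (hy : y ∈ K) (hO : O ∈ 𝓝[K] y) : ∃ L, IsCompact L ∧ L ⊆ K ∩ O ∧ L ∈ 𝓝[K] y := by
  have : CompactSpace K := isCompact_iff_compactSpace.1 hK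
  obtain ⟨L, hL, hLO, hLc⟩ := local_compact_nhds
    (preimage_coe_mem_nhds_subtype.2 hO : Subtype.val ⁻¹' O ∈ 𝓝 (⟨y, hy⟩ : K))
  refine ⟨(↑) '' L, hLc.image continuous_subtype_val, ?_, ?_⟩
  · rintro _ ⟨z, hz, rfl⟩
    exact ⟨z.2, hLO hz⟩
  · rw [← map_nhds_subtype_val (⟨y, hy⟩ : K)]
    exact Filter.image_mem_map hL

theorem compactlyCoherentSpace_iff_continuous_mk :
    CompactlyCoherentSpace Y ↔ Continuous (CompactCoherentification.mk Y) :=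
  ⟨fun _ ↦ continuous_mk, fun h ↦ .of_isOpen fun _ hS ↦
    (CompactCoherentification.isOpen_iff.2 hS).preimage h⟩

theorem compactlyCoherentSpace_of_isOpenEmbedding [T2Space Y] [CompactlyCoherentSpace Y]
    {f : A → Y} (hf : IsOpenEmbedding f) : CompactlyCoherentSpace A := by
  refine compactlyCoherentSpace_iff_continuous_mk.2 ⟨fun S hS ↦ ?_⟩
  suffices IsOpen (f '' (CompactCoherentification.mk A ⁻¹' S)) from
    hf.isOpen_iff_image_isOpen.2 this
  suffices IsOpen ((CompactCoherentification.mk Y).symm ⁻¹'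
      (f '' (CompactCoherentification.mk A ⁻¹' S))) from this.preimage continuous_mk
  rw [isOpen_compactCoherentification_iff]
  rintro K hK _ hx ⟨x, hxS, rfl⟩
  obtain ⟨L, hL, hLK, hL_nhds⟩ := exists_isCompact_subset_mem_nhdsWithin hK hx
    (mem_nhdsWithin_of_mem_nhds (hf.isOpen_range.mem_nhds ⟨x, rfl⟩))
  have hL_range : f '' (f ⁻¹' L) = L :=
    Set.image_preimage_eq_of_subset (hLK.trans Set.inter_subset_right)
  have hfL : IsCompact (f ⁻¹' L) := hf.isInducing.isCompact_iff.2 (hL_range.symm ▸ hL)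
  have hS' : CompactCoherentification.mk A ⁻¹' S ∈ 𝓝[f ⁻¹' L] x :=
    isOpen_compactCoherentification_iff.1 hS _ hfL x
      (show f x ∈ L from mem_of_mem_nhdsWithin hx hL_nhds) hxS
  refine nhdsWithin_le_of_mem hL_nhds ?_
  rw [← hL_range, ← hf.isEmbedding.map_nhdsWithin_eq]
  exact Filter.image_mem_map hS'

theorem compactlyCoherentSpace_of_forall_exists_mem_nhds
    (h : ∀ y : Y, ∃ U ∈ 𝓝 y, CompactlyCoherentSpace U) : CompactlyCoherentSpace Y := by
  refine compactlyCoherentSpace_iff_continuous_mk.2 (continuous_iff_continuousAt.2 fun y ↦ ?_)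
  obtain ⟨U, hU, _⟩ := h y
  have hUc : ContinuousOn (CompactCoherentification.mk Y) U :=
    continuousOn_iff_continuous_domRestrict.2
      ((continuous_map_of_continuous continuous_subtype_val).comp (continuous_mk (X := U)))
  exact hUc.continuousAt hU

theorem compactlyCoherentSpace_of_isLocalHomeomorph [T2Space Y] [CompactlyCoherentSpace Y]
    {p : A → Y} (hp : IsLocalHomeomorph p) : CompactlyCoherentSpace A := by
  refine compactlyCoherentSpace_of_forall_exists_mem_nhds fun a ↦ ?_
  obtain ⟨U, hU, hpU⟩ := isLocalHomeomorph_iff_isOpenEmbedding_restrict.1 hp a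
  exact ⟨U, hU, compactlyCoherentSpace_of_isOpenEmbedding hpU⟩

theorem locallyPathConnectedSpace_of_isLocalHomeomorph [LocallyPathConnectedSpace Y] {p : A → Y}
    (hp : IsLocalHomeomorph p) : LocallyPathConnectedSpace A := by
  choose e he _ using hp
  let : ChartedSpace Y A :=
    { atlas := Set.range e
      chartAt := e
      mem_chart_source := he
      chart_mem_atlas := Set.mem_range_self }
  exact ChartedSpace.locallyPathConnectedSpace Y A

theorem t2Space_of_isSeparatedMap [T2Space Y] {p : A → Y} (hp : IsSeparatedMap p)
    (hc : Continuous p) : T2Space A := by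
  refine ⟨fun a b hab ↦ ?_⟩
  by_cases h : p a = p b
  · exact hp a b h hab
  · exact separated_by_continuous hc h

theorem continuous_compactCoherentification_mk_comp [CompactlyCoherentSpace A] {f : A → Y}
    (hf : Continuous f) : Continuous (CompactCoherentification.mk Y ∘ f) :=
  (continuous_map_of_continuous hf).comp continuous_mk

theorem isOpen_setOf_forall_mem_of_isCompact [CompactlyCoherentSpace A]
    {W : Set (A × Y)} (hW : IsOpen ((CompactCoherentification.mk (A × Y)).symm ⁻¹' W)) {L : Set Y}
    (hL : IsCompact L) : IsOpen {x : A | ∀ y ∈ L, (x, y) ∈ W} := by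
  suffices IsOpen ((CompactCoherentification.mk A).symm ⁻¹' {x : A | ∀ y ∈ L, (x, y) ∈ W}) from
    this.preimage continuous_mk
  refine isOpen_compactCoherentification_iff.2 fun K hK x hx hxW ↦ ?_
  have : CompactSpace L := isCompact_iff_compactSpace.1 hL
  have h_slice (y : L) : {p : A × L | (p.1, (p.2 : Y)) ∈ W} ∈ 𝓝[K] x ×ˢ 𝓝 y := by
    have hWy := isOpen_compactCoherentification_iff.1 hW _ (hK.prod hL) (x, (y : Y))
      ⟨hx, y.2⟩ (hxW y y.2)
    rw [nhdsWithin_prod_eq, ← map_nhds_subtype_val] at hWy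
    exact Filter.tendsto_id.prodMap Filter.tendsto_map hWy
  have h_tube := isCompact_univ.mem_prod_nhdsSet_of_forall fun y _ ↦ h_slice y
  rw [nhdsSet_univ] at h_tube
  filter_upwards [Filter.mem_prod_top.1 h_tube] with z hz y hy
  exact hz ⟨y, hy⟩

theorem exists_isCompact_mem_nhdsWithin_forall_joinedIn [T2Space Y]
    [LocallyPathConnectedSpace (CompactCoherentification Y)]
    {W : Set (CompactCoherentification (A × Y))} (hW : IsOpen W) {x : A} {y : Y}
    (hxy : CompactCoherentification.mk _ (x, y) ∈ W) {K : Set Y} (hK : IsCompact K) (hy : y ∈ K) :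
    ∃ L, IsCompact L ∧ L ∈ 𝓝[K] y ∧ ∀ y' ∈ L, JoinedIn W (CompactCoherentification.mk _ (x, y))
      (CompactCoherentification.mk _ (x, y')) := by
  have h_slice : Continuous (CompactCoherentification.map (fun y' : Y ↦ (x, y'))) :=
    continuous_map_of_continuous (by fun_prop)
  let P := pathComponentIn (CompactCoherentification.map (fun y' : Y ↦ (x, y')) ⁻¹' W)
    (CompactCoherentification.mk Y y)
  have hyP : CompactCoherentification.mk Y y ∈ P := mem_pathComponentIn_self hxy
  have hP : CompactCoherentification.mk Y ⁻¹' P ∈ 𝓝[K] y :=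
    isOpen_compactCoherentification_iff (S := CompactCoherentification.mk Y ⁻¹' P) |>.1
      ((hW.preimage h_slice).pathComponentIn _) K hK y hy hyP
  obtain ⟨L, hL, hLP, hL_nhds⟩ := exists_isCompact_subset_mem_nhdsWithin hK hy hP
  refine ⟨L, hL, hL_nhds, fun y' hy' ↦ ?_⟩
  obtain ⟨β, hβ⟩ := (hLP hy').2
  exact ⟨β.map h_slice, hβ⟩

/- A path component of an open set is compactly open: move first along the second factor, inside
a compact neighbourhood, and then along the first factor, which the tube lemma permits. -/
theorem locallyPathConnectedSpace_compactCoherentification_prod [T2Space Y]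
    [CompactlyCoherentSpace A] [LocallyPathConnectedSpace A]
    [LocallyPathConnectedSpace (CompactCoherentification Y)] :
    LocallyPathConnectedSpace (CompactCoherentification (A × Y)) := by
  refine locallyPathConnectedSpace_iff_isOpen_pathComponentIn.2 fun z W hW ↦ ?_
  refine isOpen_compactCoherentification_iff (S := CompactCoherentification.mk (A × Y) ⁻¹'
    pathComponentIn W z) |>.2 ?_
  rintro K hK ⟨x, y⟩ hxy (hzxy : JoinedIn W z _)
  obtain ⟨L, hL, hL_nhds, hL_joined⟩ := exists_isCompact_mem_nhdsWithin_forall_joinedIn hW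
    hzxy.target_mem (hK.image continuous_snd) ⟨_, hxy, rfl⟩
  let V : Set A := {x | ∀ y ∈ L, CompactCoherentification.mk _ (x, y) ∈ W}
  have hxV : x ∈ V := fun y' hy' ↦ (hL_joined y' hy').target_mem
  have hV : pathComponentIn V x ∈ 𝓝 x :=
    ((isOpen_setOf_forall_mem_of_isCompact hW hL).pathComponentIn x).mem_nhds
      (mem_pathComponentIn_self hxV)
  have hVL : pathComponentIn V x ×ˢ L ∈ 𝓝[K] (x, y) :=
    nhdsWithin_mono (t := Set.univ ×ˢ (Prod.snd '' K)) _ (fun p hp ↦ ⟨trivial, p, hp, rfl⟩) <| by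
      rw [nhdsWithin_prod_eq, nhdsWithin_univ]
      exact Filter.prod_mem_prod hV hL_nhds
  filter_upwards [hVL]
  rintro ⟨x', y'⟩ ⟨⟨α, hα⟩, hy'⟩
  have h_horizontal : JoinedIn W (CompactCoherentification.mk _ (x, y'))
      (CompactCoherentification.mk _ (x', y')) :=
    ⟨α.map (continuous_compactCoherentification_mk_comp (f := fun a : A ↦ (a, y')) (by fun_prop)),
      fun t ↦ hα t y' hy'⟩
  exact hzxy.trans ((hL_joined y' hy').trans h_horizontal)

theorem locallyPathConnectedSpace_compactCoherentification_of_homeomorph (e : A ≃ₜ Y)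
    [LocallyPathConnectedSpace (CompactCoherentification Y)] :
    LocallyPathConnectedSpace (CompactCoherentification A) := by
  let e' : CompactCoherentification A ≃ₜ CompactCoherentification Y :=
    { toFun := CompactCoherentification.map e
      invFun := CompactCoherentification.map e.symm
      left_inv := e.left_inv
      right_inv := e.right_inv
      continuous_toFun := continuous_map_of_continuous e.continuous
      continuous_invFun := continuous_map_of_continuous e.symm.continuous }
  exact e'.isOpenEmbedding.locallyPathConnectedSpace

theorem locallyPathConnectedSpace_compactCoherentification_pi {k : ℕ} {B : Fin k → Type*}
    [∀ i, TopologicalSpace (B i)] [∀ i, T2Space (B i)] [∀ i, CompactlyCoherentSpace (B i)]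
    [∀ i, LocallyPathConnectedSpace (B i)] :
    LocallyPathConnectedSpace (CompactCoherentification (∀ i, B i)) := by
  induction k with
  | zero =>
    have : Subsingleton (CompactCoherentification (∀ i, B i)) :=
      (CompactCoherentification.mk _).symm.subsingleton
    exact locallyPathConnectedSpace_iff_isOpen_pathComponentIn.2 fun _ _ _ ↦ isOpen_discrete _
  | succ k ih =>
    have := ih (B := fun i ↦ B i.succ)
    have := locallyPathConnectedSpace_compactCoherentification_prod (A := B 0)
      (Y := ∀ i : Fin k, B i.succ)
    exact locallyPathConnectedSpace_compactCoherentification_of_homeomorph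
      { (Fin.consEquiv B).symm with
        continuous_toFun := by
          change Continuous fun b : ∀ i, B i ↦ (b 0, fun i : Fin k ↦ b i.succ)
          fun_prop
        continuous_invFun := continuous_fst.finCons continuous_snd }

theorem simplyConnectedSpace_compactCoherentification [SimplyConnectedSpace Y] :
    SimplyConnectedSpace (CompactCoherentification Y) := by
  let lift {x y : Y} (p : Path x y) : Path (CompactCoherentification.mk Y x)
      (CompactCoherentification.mk Y y) :=
    p.map' (continuousOn_isCompact_mk (isCompact_range p.continuous))
  refine simply_connected_iff_paths_homotopic'.2 ⟨⟨⟨CompactCoherentification.mk Y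
    (Classical.arbitrary Y)⟩, fun x y ↦ ⟨lift (PathConnectedSpace.somePath
      ((CompactCoherentification.mk Y).symm x) ((CompactCoherentification.mk Y).symm y))⟩⟩, ?_⟩
  intro x y p q
  obtain ⟨H⟩ := SimplyConnectedSpace.paths_homotopic (p.map continuous_mk_symm)
    (q.map continuous_mk_symm)
  exact ⟨{  toFun := CompactCoherentification.mk Y ∘ H
            continuous_toFun := continuous_mk_comp_iff_of_compactSpace.2 H.continuous
            map_zero_left := H.map_zero_left
            map_one_left := H.map_one_left
            prop' := H.prop' }⟩

end CompactlyGenerated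

section SimplyConnected

instance simplyConnectedSpace_prod {A B : Type*} [TopologicalSpace A] [TopologicalSpace B]
    [SimplyConnectedSpace A] [SimplyConnectedSpace B] : SimplyConnectedSpace (A × B) := by
  refine simply_connected_iff_paths_homotopic.2 ⟨inferInstance, fun x y ↦ ⟨fun p q ↦ ?_⟩⟩
  rw [← Path.Homotopic.prod_projLeft_projRight p, ← Path.Homotopic.prod_projLeft_projRight q]
  congr 1 <;> exact Subsingleton.elim _ _

instance simplyConnectedSpace_pi {ι : Type*} {B : ι → Type*} [∀ i, TopologicalSpace (B i)]
    [∀ i, SimplyConnectedSpace (B i)] : SimplyConnectedSpace (∀ i, B i) := by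
  refine simply_connected_iff_paths_homotopic.2 ⟨inferInstance, fun x y ↦ ⟨fun p q ↦ ?_⟩⟩
  rw [← Path.Homotopic.pi_proj p, ← Path.Homotopic.pi_proj q]
  exact congrArg _ (funext fun i ↦ Subsingleton.elim _ _)

end SimplyConnected

/-! ### Continuity on products of compactly generated spaces -/

namespace KContinuous

open CompactCoherentification

variable {A B Y E X : Type*} [TopologicalSpace A] [TopologicalSpace B] [TopologicalSpace Y]
  [TopologicalSpace E] [TopologicalSpace X]

theorem of_continuous {f : A → B} (hf : Continuous f) : KContinuous f :=
  hf.comp continuous_mk_symm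

theorem continuous [CompactlyCoherentSpace A] {f : A → B} (hf : KContinuous f) : Continuous f :=
  Continuous.comp (g := f ∘ (CompactCoherentification.mk A).symm) hf continuous_mk

theorem comp {g : B → Y} {f : A → B} (hg : KContinuous g) (hf : KContinuous f) :
    KContinuous (g ∘ f) :=
  Continuous.comp (g := g ∘ (CompactCoherentification.mk B).symm) hg
    (continuous_compactCoherentification_mk_comp hf)

theorem prodMk {f : A → B} {g : A → Y} (hf : KContinuous f) (hg : KContinuous g) :
    KContinuous fun a ↦ (f a, g a) :=
  Continuous.prodMk hf hg

theorem pi {ι : Type*} {B : ι → Type*} [∀ i, TopologicalSpace (B i)] {f : ∀ i, A → B i}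
    (hf : ∀ i, KContinuous (f i)) : KContinuous fun a i ↦ f i a :=
  continuous_pi hf

/-- The image of a path under a map that is continuous on compact sets. -/
def mapPath {f : A → B} (hf : KContinuous f) {a b : A} (γ : Path a b) : Path (f a) (f b) where
  toFun := f ∘ γ
  continuous_toFun := hf.comp_path γ.continuous
  source' := congrArg f γ.source
  target' := congrArg f γ.target

theorem homotopic_mapPath {f : A → B} (hf : KContinuous f) {a b : A} {γ γ' : Path a b}
    (h : γ.Homotopic γ') : (hf.mapPath γ).Homotopic (hf.mapPath γ') := by
  obtain ⟨H⟩ := h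
  exact ⟨{ toFun := f ∘ H
           continuous_toFun := (hf.comp (of_continuous H.continuous)).continuous
           map_zero_left := fun t ↦ congrArg f (H.map_zero_left t)
           map_one_left := fun t ↦ congrArg f (H.map_one_left t)
           prop' := fun t s hs ↦ congrArg f (H.prop t s hs) }⟩

/-- The map induced on homotopy classes of paths by a map that is continuous on compact sets. -/
def mapClass {f : A → B} (hf : KContinuous f) {a b : A} :
    Path.Homotopic.Quotient a b → Path.Homotopic.Quotient (f a) (f b) :=
  Quotient.map hf.mapPath fun _ _ ↦ hf.homotopic_mapPath

theorem eq_of_comp_eq [PathConnectedSpace A] {p : E → X} (hp : IsCoveringMap p) {f g : A → E}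
    (hf : KContinuous f) (hg : KContinuous g) (hfg : p ∘ f = p ∘ g) {a : A} (ha : f a = g a) :
    f = g := by
  funext b
  let γ := PathConnectedSpace.somePath a b
  have h := hp.eq_of_comp_eq (hf.mapPath γ).continuous (hg.mapPath γ).continuous
    (funext fun t ↦ congrFun hfg (γ t)) 0 (by simpa using ha)
  simpa using congrFun h 1

theorem exists_lift [SimplyConnectedSpace A]
    [LocallyPathConnectedSpace (CompactCoherentification A)] {p : E → X}
    (hp : IsCoveringMap p) {f : A → X} (hf : KContinuous f) {a : A} {e : E} (he : p e = f a) :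
    ∃ F : A → E, KContinuous F ∧ F a = e ∧ p ∘ F = f := by
  have := simplyConnectedSpace_compactCoherentification (Y := A)
  obtain ⟨F, ⟨hFe, hpF⟩, -⟩ := hp.existsUnique_continuousMap_lifts
    ⟨f ∘ (CompactCoherentification.mk A).symm, hf⟩ (CompactCoherentification.mk A a) e he
  exact ⟨F ∘ CompactCoherentification.mk A, F.continuous, hFe, hpF⟩

end KContinuous

/-! ### The universal cover of a pointed space -/

section PathClasses

variable {X : Type*} [TopologicalSpace X] {x y z : X}

theorem pathClass_trans_right_cancel {p q : Path.Homotopic.Quotient x y}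
    {r : Path.Homotopic.Quotient y z} (h : p.trans r = q.trans r) : p = q := by
  simpa using congrArg (·.trans r.symm) h

theorem pathClass_trans_symm_trans (p : Path.Homotopic.Quotient x z)
    (q : Path.Homotopic.Quotient y z) : (p.trans q.symm).trans q = p := by
  simp

theorem pathClass_trans_left_cancel {r : Path.Homotopic.Quotient x y}
    {p q : Path.Homotopic.Quotient y z} (h : r.trans p = r.trans q) : p = q := by
  simpa [← Path.Homotopic.Quotient.trans_assoc] using congrArg (r.symm.trans ·) h

theorem SemilocallySimplyConnected.exists_isOpen_forall_homotopic
    (h : SemilocallySimplyConnected X) (x : X) : ∃ U : Set X, IsOpen U ∧ x ∈ U ∧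
      ∀ (y : X) (γ γ' : Path x y), Set.range γ ⊆ U → Set.range γ' ⊆ U → γ.Homotopic γ' := by
  obtain ⟨V, hV, hV_loops⟩ := h x
  obtain ⟨U, hUV, hU, hx⟩ := mem_nhds_iff.1 hV
  refine ⟨U, hU, hx, fun y γ γ' hγ hγ' ↦ ?_⟩
  have h_loop := hV_loops (γ.trans γ'.symm) (by
    rw [Path.trans_range, Path.symm_range]
    exact (Set.union_subset hγ hγ').trans hUV)
  rw [← Path.Homotopic.Quotient.eq] at h_loop ⊢
  exact pathClass_trans_right_cancel (r := (Path.Homotopic.Quotient.mk γ').symm)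
    (by simpa using h_loop)

theorem eventually_range_subpath_subset (δ : Path x y) {U : Set X} (hU : IsOpen U)
    {t : unitInterval} (ht : δ t ∈ U) : ∀ᶠ s in 𝓝 t, Set.range (δ.subpath t s) ⊆ U := by
  have h_cont : Continuous fun z : unitInterval × unitInterval ↦ δ.subpath t z.1 z.2 :=
    δ.subpath_continuous_family.comp
      (continuous_const.prodMk (continuous_fst.prodMk continuous_snd))
  have h_ev : ∀ᶠ s in 𝓝 t, ∀ r ∈ (Set.univ : Set unitInterval), δ.subpath t s r ∈ U :=
    isCompact_univ.eventually_forall_of_forall_eventually fun r _ ↦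
      h_cont.continuousAt (hU.mem_nhds (by simpa using ht))
  filter_upwards [h_ev] with s hs
  exact Set.range_subset_iff.2 fun r ↦ hs r trivial

end PathClasses

namespace UnivCover

variable {X : Type*} [TopologicalSpace X] {e : X}

theorem mem_nhd_self {a : UnivCover X e} {U : Set X} (h : a.proj ∈ U) : a ∈ a.nhd U :=
  ⟨Path.refl _, by simpa [proj] using h, by simp⟩

theorem mem_nhd_trans {a b c : UnivCover X e} {U : Set X} (hab : b ∈ a.nhd U) (hbc : c ∈ b.nhd U) :
    c ∈ a.nhd U := by
  obtain ⟨η, hη, hb⟩ := hab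
  obtain ⟨η', hη', hc⟩ := hbc
  refine ⟨η.trans η', ?_, by simp [hb, hc]⟩
  rw [Path.trans_range]
  exact Set.union_subset hη hη'

theorem nhd_mono (a : UnivCover X e) {U V : Set X} (h : U ⊆ V) : a.nhd U ⊆ a.nhd V :=
  fun _ ⟨η, hη, hb⟩ ↦ ⟨η, hη.trans h, hb⟩

theorem proj_mem_of_mem_nhd {a b : UnivCover X e} {U : Set X} (h : b ∈ a.nhd U) : b.proj ∈ U := by
  obtain ⟨η, hη, -⟩ := h
  exact hη ⟨1, η.target⟩

theorem isTopologicalBasis_nhd : TopologicalSpace.IsTopologicalBasis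
    {S | ∃ (a : UnivCover X e) (U : Set X), IsOpen U ∧ a.proj ∈ U ∧ S = a.nhd U} where
  exists_subset_inter := by
    rintro _ ⟨a, U, hU, -, rfl⟩ _ ⟨b, V, hV, -, rfl⟩ c ⟨hac, hbc⟩
    have hc : c.proj ∈ U ∩ V := ⟨proj_mem_of_mem_nhd hac, proj_mem_of_mem_nhd hbc⟩
    exact ⟨_, ⟨c, U ∩ V, hU.inter hV, hc, rfl⟩, mem_nhd_self hc, fun d hd ↦
      ⟨mem_nhd_trans hac (nhd_mono _ Set.inter_subset_left hd),
        mem_nhd_trans hbc (nhd_mono _ Set.inter_subset_right hd)⟩⟩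
  sUnion_eq := Set.eq_univ_of_forall fun a ↦
    ⟨_, ⟨a, Set.univ, isOpen_univ, trivial, rfl⟩, mem_nhd_self trivial⟩
  eq_generateFrom := rfl

theorem mem_nhds_iff {a : UnivCover X e} {S : Set (UnivCover X e)} :
    S ∈ 𝓝 a ↔ ∃ U, IsOpen U ∧ a.proj ∈ U ∧ a.nhd U ⊆ S := by
  rw [isTopologicalBasis_nhd.mem_nhds_iff]
  constructor
  · rintro ⟨_, ⟨b, U, hU, -, rfl⟩, ha, hS⟩
    exact ⟨U, hU, proj_mem_of_mem_nhd ha, fun c hc ↦ hS (mem_nhd_trans ha hc)⟩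
  · rintro ⟨U, hU, ha, hS⟩
    exact ⟨_, ⟨a, U, hU, ha, rfl⟩, mem_nhd_self ha, hS⟩

theorem continuous_proj : Continuous (proj : UnivCover X e → X) := by
  refine continuous_iff_continuousAt.2 fun a S hS ↦ ?_
  obtain ⟨U, hUS, hU, ha⟩ := _root_.mem_nhds_iff.1 hS
  exact mem_nhds_iff.2 ⟨U, hU, ha, fun b hb ↦ hUS (proj_mem_of_mem_nhd hb)⟩

theorem isOpenMap_proj [LocallyPathConnectedSpace X] : IsOpenMap (proj : UnivCover X e → X) := by
  refine IsOpenMap.of_nhds_le fun a S hS ↦ ?_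
  obtain ⟨U, hU, ha, hUS⟩ := mem_nhds_iff.1 hS
  filter_upwards [(hU.pathComponentIn a.proj).mem_nhds (mem_pathComponentIn_self ha)] with x hx
  obtain ⟨η, hη⟩ := hx
  exact hUS (show (⟨x, a.2.trans (.mk η)⟩ : UnivCover X e) ∈ a.nhd U from
    ⟨η, Set.range_subset_iff.2 hη, rfl⟩)

theorem surjective_proj [PathConnectedSpace X] :
    Function.Surjective (proj : UnivCover X e → X) := fun x ↦
  ⟨mk (PathConnectedSpace.somePath e x), rfl⟩

theorem exists_mk_eq (a : UnivCover X e) : ∃ (x : X) (α : Path e x), mk α = a := by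
  obtain ⟨x, p⟩ := a
  induction p with | mk α => exact ⟨x, α, rfl⟩

theorem mk_congr {x y : X} {δ : Path e x} {δ' : Path e y} (h : ∀ t, δ t = δ' t) :
    mk δ = mk δ' := by
  obtain rfl : x = y := by simpa using h 1
  rw [show δ = δ' from Path.ext (funext h)]

instance [Subsingleton X] : Subsingleton (UnivCover X e) where
  allEq a b := by
    obtain ⟨_, α, rfl⟩ := a.exists_mk_eq
    obtain ⟨_, β, rfl⟩ := b.exists_mk_eq
    exact mk_congr fun _ ↦ Subsingleton.elim _ _

/-- The class of the concatenation `α · δ`, for `a = [α]`. -/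
noncomputable def extend (a : UnivCover X e) {x : X} (δ : Path a.proj x) : UnivCover X e :=
  ⟨x, a.2.trans (.mk δ)⟩

theorem base_extend {x : X} (α : Path e x) : (base e).extend α = mk α :=
  congrArg (Sigma.mk x) (Path.Homotopic.Quotient.refl_trans _)

theorem mem_nhd_iff {a b : UnivCover X e} {U : Set X} :
    b ∈ a.nhd U ↔ ∃ δ : Path a.proj b.proj, Set.range δ ⊆ U ∧ a.extend δ = b :=
  exists_congr fun _ ↦ and_congr_right fun _ ↦
    ⟨fun h ↦ congrArg (Sigma.mk b.1) h.symm, fun h ↦ (eq_of_heq (Sigma.mk.inj h).2).symm⟩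

theorem extend_refl (a : UnivCover X e) : a.extend (Path.refl a.proj) = a :=
  congrArg (Sigma.mk a.1) (Path.Homotopic.Quotient.trans_refl a.2)

theorem extend_congr (a : UnivCover X e) {x y : X} {δ : Path a.proj x} {δ' : Path a.proj y}
    (h : ∀ t, δ t = δ' t) : a.extend δ = a.extend δ' := by
  obtain rfl : x = y := by simpa using h 1
  rw [show δ = δ' from Path.ext (funext h)]

theorem extend_trans (a : UnivCover X e) {x y : X} (δ : Path a.proj x) (δ' : Path x y) :
    a.extend (δ.trans δ') = (a.extend δ).extend δ' :=
  congrArg (Sigma.mk y) (Path.Homotopic.Quotient.trans_assoc a.2 (.mk δ) (.mk δ')).symm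

theorem extend_eq_of_homotopic (a : UnivCover X e) {x : X} {δ δ' : Path a.proj x}
    (h : δ.Homotopic δ') : a.extend δ = a.extend δ' :=
  congrArg (fun p ↦ (⟨x, a.2.trans p⟩ : UnivCover X e)) (Path.Homotopic.Quotient.eq.2 h)

theorem extend_subpath (a : UnivCover X e) {x : X} (δ : Path a.proj x) (t s : unitInterval) :
    (a.extend ((δ.subpath 0 t).cast δ.source.symm rfl)).extend (δ.subpath t s) =
      a.extend ((δ.subpath 0 s).cast δ.source.symm rfl) := by
  rw [← extend_trans]
  exact extend_eq_of_homotopic _ (Path.Homotopic.pathCast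
    ⟨Path.Homotopy.subpathTransSubpath δ 0 t s⟩ δ.source.symm rfl)

/-- The path `t ↦ [α · δ|_{[0, t]}]` in the universal cover, which lifts `δ`. -/
noncomputable def liftPath (a : UnivCover X e) {x : X} (δ : Path a.proj x) :
    Path a (a.extend δ) where
  toFun t := a.extend ((δ.subpath 0 t).cast δ.source.symm rfl)
  continuous_toFun := by
    refine continuous_iff_continuousAt.2 fun t S hS ↦ Filter.mem_map.2 ?_
    obtain ⟨U, hU, ht, hUS⟩ := mem_nhds_iff.1 hS
    filter_upwards [eventually_range_subpath_subset δ hU ht] with s hs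
    exact hUS (mem_nhd_iff.2 ⟨δ.subpath t s, hs, extend_subpath a δ t s⟩)
  source' := (extend_congr a (δ' := Path.refl _) fun t ↦ by simp).trans (extend_refl a)
  target' := extend_congr a fun t ↦ by simp

theorem joined_base (a : UnivCover X e) : Joined (base e) a := by
  obtain ⟨_, α, rfl⟩ := exists_mk_eq a
  rw [← base_extend]
  exact ⟨liftPath _ _⟩

instance : PathConnectedSpace (UnivCover X e) where
  nonempty := ⟨base e⟩
  joined a b := a.joined_base.symm.trans b.joined_base

section IsCoveringMap

variable (hp : IsCoveringMap (proj : UnivCover X e → X))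
include hp

theorem extend_eq_of_path {a b : UnivCover X e} (Γ : Path a b) {x : X} {δ : Path a.proj x}
    (h : ∀ t, (Γ t).proj = δ t) : a.extend δ = b := by
  have h_lift := hp.eq_of_comp_eq (a.liftPath δ).continuous Γ.continuous
    (funext fun t ↦ (h t).symm) 0 (by simp)
  simpa using congrFun h_lift 1

theorem simplyConnectedSpace : SimplyConnectedSpace (UnivCover X e) := by
  refine simply_connected_iff_paths_homotopic.2 ⟨inferInstance, fun a b ↦ ⟨fun p q ↦ ?_⟩⟩
  refine hp.injective_path_homotopic_map a b ?_
  induction p with | mk p =>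
  induction q with | mk q =>
  have h : a.extend (p.map continuous_proj) = a.extend (q.map continuous_proj) :=
    (extend_eq_of_path hp p fun _ ↦ rfl).trans (extend_eq_of_path hp q fun _ ↦ rfl).symm
  exact pathClass_trans_left_cancel (eq_of_heq (Sigma.mk.inj h).2)

end IsCoveringMap

theorem eq_of_mem_nhd {a b c : UnivCover X e} {U : Set X}
    (hU : ∀ (y : X) (γ γ' : Path a.proj y), Set.range γ ⊆ U → Set.range γ' ⊆ U → γ.Homotopic γ')
    (hb : b ∈ a.nhd U) (hc : c ∈ a.nhd U) (h : b.proj = c.proj) : b = c := by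
  obtain ⟨δ, hδ, hb⟩ := mem_nhd_iff.1 hb
  obtain ⟨δ', hδ', hc⟩ := mem_nhd_iff.1 hc
  have h_range : Set.range (δ'.cast rfl h) ⊆ U := hδ'
  calc b = a.extend δ := hb.symm
    _ = a.extend (δ'.cast rfl h) := extend_eq_of_homotopic a (hU _ _ _ hδ h_range)
    _ = a.extend δ' := extend_congr a fun _ ↦ rfl
    _ = c := hc

end UnivCover

/-! ### Covering actions and the fundamental group of an orbit space -/

section IsCoveringAction

variable {G P X E : Type*} [Group G] [TopologicalSpace X] [MulAction G X] [ContinuousConstSMul G X]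
  [Group P] [TopologicalSpace E] [MulAction P E] [ContinuousConstSMul P E]

theorem isCoveringAction_iff : IsCoveringAction G X ↔
    ∀ x : X, ∃ U ∈ 𝓝 x, ∀ g : G, ((g • ·) '' U ∩ U).Nonempty → g = 1 := by
  refine forall_congr' fun x ↦ exists_congr fun U ↦ and_congr_right fun _ ↦
    ⟨fun h g hg ↦ h g 1 (by simpa using hg), fun h g g' ↦ ?_⟩
  rintro ⟨_, ⟨y, hy, rfl⟩, z, hz, hzy⟩
  refine inv_mul_eq_one.1 (h (g⁻¹ * g') ⟨y, ⟨z, hz, ?_⟩, hy⟩) |>.symm ▸ rfl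
  exact (mul_smul ..).trans (inv_smul_eq_iff.2 hzy)

namespace IsCoveringAction

theorem eq_of_smul_eq (hG : IsCoveringAction G X) {g h : G} {x : X} (hx : g • x = h • x) :
    g = h := by
  obtain ⟨U, hU, hU'⟩ := hG x
  exact hU' g h ⟨_, ⟨x, mem_of_mem_nhds hU, rfl⟩, x, mem_of_mem_nhds hU, hx.symm⟩

theorem isQuotientCoveringMap (hG : IsCoveringAction G X) :
    IsQuotientCoveringMap (Quotient.mk (MulAction.orbitRel G X)) G where
  toIsQuotientMap := isQuotientMap_quotient_mk'
  apply_eq_iff_mem_orbit := Quotient.eq''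
  disjoint := isCoveringAction_iff.1 hG

instance continuousConstSMul_subgroup {H : Subgroup P} : ContinuousConstSMul H E :=
  ⟨fun g ↦ continuous_const_smul (g : P)⟩

theorem of_ker {φ : P →* G} {p : E → X} (hp : Continuous p)
    (hp_smul : ∀ (g : P) (z : E), p (g • z) = φ g • p z) (hG : IsCoveringAction G X)
    (hker : IsCoveringAction φ.ker E) : IsCoveringAction P E := by
  rw [isCoveringAction_iff] at *
  intro z
  obtain ⟨U, hU, hU'⟩ := hker z
  obtain ⟨V, hV, hV'⟩ := hG (p z)
  refine ⟨U ∩ p ⁻¹' V, Filter.inter_mem hU (hp.continuousAt hV), fun g ↦ ?_⟩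
  rintro ⟨_, ⟨w, hw, rfl⟩, hgw⟩
  have hg : φ g = 1 := hV' _ ⟨p (g • w), ⟨p w, hw.2, (hp_smul g w).symm⟩, hgw.2⟩
  exact congrArg Subtype.val (hU' ⟨g, hg⟩ ⟨g • w, ⟨w, hw.1, rfl⟩, hgw.1⟩)

end IsCoveringAction

end IsCoveringAction

namespace OrbitPi1

variable {G X : Type*} [TopologicalSpace X] [Group G] [MulAction G X] [ContinuousConstSMul G X]
  {e : X}

section UnivCover

theorem proj_smul (p : OrbitPi1 G X e) (z : UnivCover X e) :
    (p • z).proj = p.toGroup • z.proj := rfl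

theorem mk_smul_base (g : G) (f : Path e (g • e)) :
    mk g f • UnivCover.base e = UnivCover.mk f :=
  congrArg (Sigma.mk (g • e)) (Path.Homotopic.Quotient.trans_refl _)

theorem eq_of_smul_eq {p q : OrbitPi1 G X e} (h : p.toGroup = q.toGroup) {z : UnivCover X e}
    (hz : p • z = q • z) : p = q := by
  obtain ⟨g, f⟩ := p
  obtain ⟨g', f'⟩ := q
  obtain rfl : g = g' := h
  exact congrArg (Sigma.mk g) (pathClass_trans_right_cancel (eq_of_heq (Sigma.mk.inj hz).2))

/-- For `w` over `g • p z`, the element of `π₁(X; e, Ge)` over `g` that carries `z = [α]` to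
`w = [β]`: the class of `β · (gα)⁻¹`. -/
noncomputable def connecting (g : G) (z w : UnivCover X e) (h : w.proj = g • z.proj) :
    OrbitPi1 G X e :=
  ⟨g, (w.2.cast rfl h.symm).trans (z.2.translate g).symm⟩

theorem toGroup_connecting (g : G) (z w : UnivCover X e) (h : w.proj = g • z.proj) :
    (connecting g z w h).toGroup = g := rfl

theorem connecting_smul (g : G) (z w : UnivCover X e) (h : w.proj = g • z.proj) :
    connecting g z w h • z = w :=
  UnivCover.ext h.symm (pathClass_trans_symm_trans (w.2.cast rfl h.symm) (z.2.translate g))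

theorem surjective_toGroup [PathConnectedSpace X] :
    Function.Surjective (toGroup : OrbitPi1 G X e →* G) := fun g ↦
  ⟨mk g (PathConnectedSpace.somePath _ _), rfl⟩

theorem proj_eq_iff_exists_smul_eq {z w : UnivCover X e} :
    z.proj = w.proj ↔ ∃ p : pi1 G X e, p • w = z := by
  constructor
  · intro h
    have h' : z.proj = (1 : G) • w.proj := by rwa [one_smul]
    exact ⟨⟨connecting 1 w z h', toGroup_connecting ..⟩, connecting_smul _ _ _ h'⟩
  · rintro ⟨⟨p, hp⟩, rfl⟩
    exact (proj_smul p w).trans (by rw [MonoidHom.mem_ker.1 hp, one_smul])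

theorem isCoveringAction_pi1 (hX : SemilocallySimplyConnected X) :
    IsCoveringAction (pi1 G X e) (UnivCover X e) := by
  refine isCoveringAction_iff.2 fun z ↦ ?_
  obtain ⟨U, hU, hz, hU'⟩ := hX.exists_isOpen_forall_homotopic z.proj
  refine ⟨z.nhd U, UnivCover.mem_nhds_iff.2 ⟨U, hU, hz, subset_rfl⟩, ?_⟩
  rintro p ⟨_, ⟨w, hw, rfl⟩, hpw⟩
  have h_fix : p • w = w := UnivCover.eq_of_mem_nhd hU' hpw hw
    (proj_eq_iff_exists_smul_eq.2 ⟨p, rfl⟩)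
  exact Subtype.ext (eq_of_smul_eq (p.2.trans (map_one _).symm) (h_fix.trans (one_smul _ w).symm))

theorem isCoveringAction (hX : SemilocallySimplyConnected X) (hG : IsCoveringAction G X) :
    IsCoveringAction (OrbitPi1 G X e) (UnivCover X e) :=
  .of_ker UnivCover.continuous_proj proj_smul hG (isCoveringAction_pi1 hX)

variable (G) in
theorem isQuotientCoveringMap_proj [PathConnectedSpace X] [LocallyPathConnectedSpace X]
    (hX : SemilocallySimplyConnected X) :
    IsQuotientCoveringMap (UnivCover.proj : UnivCover X e → X) (pi1 G X e) where
  toIsQuotientMap := UnivCover.isOpenMap_proj.isQuotientMap UnivCover.continuous_proj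
    UnivCover.surjective_proj
  continuous_const_smul p := continuous_const_smul (p : OrbitPi1 G X e)
  apply_eq_iff_mem_orbit := proj_eq_iff_exists_smul_eq
  disjoint := isCoveringAction_iff.1 (isCoveringAction_pi1 hX)

end UnivCover

section ToLoop

theorem toLoop_mul (p q : OrbitPi1 G X e) : (p * q).toLoop = p.toLoop.trans q.toLoop := by
  obtain ⟨g, f⟩ := p
  obtain ⟨g', f'⟩ := q
  induction f with | mk f =>
  induction f' with | mk f' =>
  refine congrArg Path.Homotopic.Quotient.mk ?_
  ext t
  simp only [Path.cast_coe, Path.map_coe, Function.comp_apply, Path.trans_apply]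
  split_ifs with h
  · rfl
  · exact Quotient.sound ⟨g, rfl⟩

theorem map_quotientMk_eq_toLoop_cast (hG : IsCoveringAction G X) (p : OrbitPi1 G X e) :
    p.2.map ⟨_, hG.isQuotientCoveringMap.continuous⟩ =
      p.toLoop.cast rfl (hG.isQuotientCoveringMap.map_smul p.toGroup) := by
  simp only [toLoop, Path.Homotopic.Quotient.cast_cast]
  exact (Path.Homotopic.Quotient.cast_rfl_rfl _).symm

theorem monodromy_toLoop (hG : IsCoveringAction G X) (p : OrbitPi1 G X e) :
    (hG.isQuotientCoveringMap.isCoveringMap.monodromy p.toLoop ⟨e, rfl⟩).1 = p.toGroup • e :=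
  congrArg Subtype.val (hG.isQuotientCoveringMap.isCoveringMap.monodromy_eq_of_map_eq
    (ex := ⟨e, rfl⟩) (ey := ⟨p.toGroup • e, hG.isQuotientCoveringMap.map_smul p.toGroup⟩) p.2
    (map_quotientMk_eq_toLoop_cast hG p))

theorem injective_toLoop (hG : IsCoveringAction G X) :
    Function.Injective (toLoop : OrbitPi1 G X e → _) := by
  intro p q hpq
  have h_group : p.toGroup = q.toGroup := hG.eq_of_smul_eq (x := e) <| by
    rw [← monodromy_toLoop hG, ← monodromy_toLoop hG, hpq]
  obtain ⟨g, f⟩ := p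
  obtain ⟨g', f'⟩ := q
  obtain rfl : g = g' := h_group
  refine congrArg (Sigma.mk g)
    (hG.isQuotientCoveringMap.isCoveringMap.injective_path_homotopic_map _ _ ?_)
  exact (map_quotientMk_eq_toLoop_cast hG ⟨g, f⟩).trans
    (Eq.trans (by rw [hpq]; rfl) (map_quotientMk_eq_toLoop_cast hG ⟨g, f'⟩).symm)

theorem surjective_toLoop (hG : IsCoveringAction G X) :
    Function.Surjective (toLoop : OrbitPi1 G X e → _) := by
  intro l
  have hq := hG.isQuotientCoveringMap.isCoveringMap
  obtain ⟨g, hg⟩ := hG.isQuotientCoveringMap.apply_eq_iff_mem_orbit.1 (hq.monodromy l ⟨e, rfl⟩).2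
  have h_lift := hq.map_liftPathQuotient l ⟨e, rfl⟩
  refine ⟨⟨g, (hq.liftPathQuotient l ⟨e, rfl⟩).cast rfl hg⟩, ?_⟩
  simp only [toLoop, Path.Homotopic.Quotient.map_cast]
  rw [h_lift]
  exact ((Path.Homotopic.Quotient.cast_cast _ _ _ _ _).trans
    (Path.Homotopic.Quotient.cast_cast _ _ _ _ _)).trans (Path.Homotopic.Quotient.cast_rfl_rfl _)

theorem bijective_toLoop (hG : IsCoveringAction G X) :
    Function.Bijective (toLoop : OrbitPi1 G X e → _) :=
  ⟨injective_toLoop hG, surjective_toLoop hG⟩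

end ToLoop

end OrbitPi1

/-! ### Blocks -/

theorem blockEquiv_lt_iff {k n : ℕ} (m : Fin k → ℕ) (h : ∑ i, m i = n) {p q : Σ i, Fin (m i)} :
    blockEquiv m h p < blockEquiv m h q ↔ Sigma.Lex (· < ·) (fun _ ↦ (· < ·)) p q := by
  have hmono : StrictMono fun j ↦ toLex ((blockEquiv m h).symm j) := fun i j hij ↦ by
    obtain ⟨⟨i, x⟩, rfl⟩ := (blockEquiv m h).surjective i
    obtain ⟨⟨j, y⟩, rfl⟩ := (blockEquiv m h).surjective j
    simp only [Equiv.symm_apply_apply]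
    rcases LittleIntervals₀.lex_of_lt m h _ _ hij with hij | ⟨e, hxy⟩
    · exact .left _ _ hij
    · dsimp only at e
      subst e
      exact .right _ _ hxy
  have hiff := (hmono.lt_iff_lt (a := blockEquiv m h p) (b := blockEquiv m h q)).symm
  simp only [Equiv.symm_apply_apply] at hiff
  exact hiff

theorem equiv_fin_eq_of_lt_imp_lt {T : Type*} {n : ℕ} (e : T ≃ Fin n) {g : T → Fin n}
    (h : ∀ s t, e s < e t → g s < g t) : ⇑e = g := by
  have hmono : StrictMono (g ∘ e.symm) := fun i j hij ↦ h _ _ (by simpa using hij)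
  exact (e.eq_comp_symm id g).1 (le_antisymm hmono.id_le hmono.le_id)

theorem blockEquiv_blockEquiv {k N n : ℕ} (m : Fin k → ℕ) (h : ∑ i, m i = N) (l : Fin N → ℕ)
    (h₁ : ∑ j, l j = n) (h₂ : ∑ i, ∑ x, l (blockEquiv m h ⟨i, x⟩) = n) (i : Fin k)
    (x : Fin (m i)) (y : Fin (l (blockEquiv m h ⟨i, x⟩))) :
    blockEquiv l h₁ ⟨blockEquiv m h ⟨i, x⟩, y⟩ =
      blockEquiv (fun i ↦ ∑ x, l (blockEquiv m h ⟨i, x⟩)) h₂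
        ⟨i, blockEquiv (fun x ↦ l (blockEquiv m h ⟨i, x⟩)) rfl ⟨x, y⟩⟩ := by
  refine congrFun (equiv_fin_eq_of_lt_imp_lt
    (e := (Equiv.sigmaCongrLeft (β := fun j ↦ Fin (l j)) (blockEquiv m h)).trans (blockEquiv l h₁))
    (g := fun r ↦ blockEquiv (fun i ↦ ∑ x, l (blockEquiv m h ⟨i, x⟩)) h₂
      ⟨r.1.1, blockEquiv (fun x ↦ l (blockEquiv m h ⟨r.1.1, x⟩)) rfl ⟨r.1.2, r.2⟩⟩) ?_)
    ⟨⟨i, x⟩, y⟩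
  rintro ⟨p, y⟩ ⟨q, y'⟩ hlt
  replace hlt : Sigma.Lex _ _ (⟨blockEquiv m h p, y⟩ : Σ j, Fin (l j)) ⟨blockEquiv m h q, y'⟩ :=
    (blockEquiv_lt_iff l h₁).1 hlt
  refine (blockEquiv_lt_iff _ h₂).2 ?_
  rcases Sigma.lex_iff.1 hlt with hpq | ⟨e, hy⟩
  · obtain ⟨_, _, hij⟩ | ⟨_, _, hxx'⟩ := (blockEquiv_lt_iff m h).1 hpq
    · exact .left _ _ hij
    · exact .right _ _ ((blockEquiv_lt_iff _ rfl).2 (.left _ _ hxx'))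
  · obtain rfl := (blockEquiv m h).injective e
    exact .right _ _ ((blockEquiv_lt_iff _ rfl).2 (.right _ _ hy))

theorem blockEquiv_one {n : ℕ} (h : ∑ _ : Fin 1, n = n) (x : Fin n) :
    blockEquiv (fun _ : Fin 1 ↦ n) h ⟨0, x⟩ = x :=
  Fin.ext (by simp [blockEquiv, finSigmaFinEquiv_apply])

theorem blockEquiv_ones {n : ℕ} (h : ∑ _ : Fin n, 1 = n) (i : Fin n) :
    blockEquiv (fun _ : Fin n ↦ 1) h ⟨i, 0⟩ = i :=
  Fin.ext (by simp [blockEquiv, finSigmaFinEquiv_apply])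

theorem symComp_symm_blockEquiv {k n : ℕ} (m : Fin k → ℕ) (h : ∑ i, m i = n)
    (σ : Equiv.Perm (Fin k)) (τ : ∀ i, Equiv.Perm (Fin (m i))) (j : Fin k)
    (x : Fin (m (σ.symm j))) :
    (symComp m h σ τ).symm (blockEquiv (fun j ↦ m (σ.symm j)) (sum_perm h σ) ⟨j, x⟩) =
      blockEquiv m h ⟨σ.symm j, (τ (σ.symm j)).symm x⟩ := by
  rw [Equiv.symm_apply_eq]
  simp only [symComp, Equiv.trans_apply, Equiv.symm_apply_apply]
  refine congrArg _ (Sigma.ext (σ.apply_symm_apply j).symm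
    ((Fin.heq_ext_iff (congrArg m (σ.symm_apply_apply _).symm)).2 ?_))
  exact (congrArg Fin.val ((τ _).apply_symm_apply x)).symm

/-! ### Little intervals -/

namespace LittleIntervals₀

open LittleIntervals (ordered_combo)

theorem comp_blockEquiv {k n : ℕ} (m : Fin k → ℕ) (h : ∑ i, m i = n) (a : LittleIntervals₀ k)
    (b : ∀ i, LittleIntervals₀ (m i)) (i : Fin k) (x : Fin (m i)) :
    (comp m h a b).1.1 (blockEquiv m h ⟨i, x⟩) =
      ((a.1.1 i).1 + ((a.1.1 i).2 - (a.1.1 i).1) * ((b i).1.1 x).1,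
        (a.1.1 i).1 + ((a.1.1 i).2 - (a.1.1 i).1) * ((b i).1.1 x).2) := by
  simp only [comp, ofOrdered, LittleIntervals.ofOrdered, compFun]
  rw [Equiv.symm_apply_apply]

theorem comp_assoc {k N n : ℕ} (m : Fin k → ℕ) (h : ∑ i, m i = N) (l : Fin N → ℕ)
    (h₁ : ∑ j, l j = n) (h₂ : ∑ i, ∑ x, l (blockEquiv m h ⟨i, x⟩) = n) (a : LittleIntervals₀ k)
    (b : ∀ i, LittleIntervals₀ (m i)) (c : ∀ j, LittleIntervals₀ (l j)) :
    comp l h₁ (comp m h a b) c =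
      comp (fun i ↦ ∑ x, l (blockEquiv m h ⟨i, x⟩)) h₂ a
        (fun i ↦ comp (fun x ↦ l (blockEquiv m h ⟨i, x⟩)) rfl (b i)
          (fun x ↦ c (blockEquiv m h ⟨i, x⟩))) := by
  refine Subtype.ext (Subtype.ext (funext fun j ↦ ?_))
  obtain ⟨⟨J, y⟩, rfl⟩ := (blockEquiv l h₁).surjective j
  obtain ⟨⟨i, x⟩, rfl⟩ := (blockEquiv m h).surjective J
  rw [comp_blockEquiv, comp_blockEquiv, blockEquiv_blockEquiv m h l h₁ h₂, comp_blockEquiv,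
    comp_blockEquiv]
  ext <;> ring

theorem std_one_comp {n : ℕ} (h : ∑ _ : Fin 1, n = n) (a : LittleIntervals₀ n) :
    comp (fun _ : Fin 1 ↦ n) h (std 1) (fun _ ↦ a) = a := by
  refine Subtype.ext (Subtype.ext (funext fun j ↦ ?_))
  conv_lhs => rw [← blockEquiv_one h j, comp_blockEquiv]
  ext <;> simp [std, LittleIntervals.std, LittleIntervals.ofOrdered]

theorem comp_std_one {n : ℕ} (h : ∑ _ : Fin n, 1 = n) (a : LittleIntervals₀ n) :
    comp (fun _ : Fin n ↦ 1) h a (fun _ ↦ std 1) = a := by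
  refine Subtype.ext (Subtype.ext (funext fun j ↦ ?_))
  conv_lhs => rw [← blockEquiv_ones h j, comp_blockEquiv]
  ext <;> simp [std, LittleIntervals.std, LittleIntervals.ofOrdered]

theorem homotopic {k : ℕ} {a b : LittleIntervals₀ k} (γ γ' : Path a b) : γ.Homotopic γ' := by
  refine ⟨{ toFun := fun z ↦ ofOrdered (ordered_combo (γ z.2).ordered (γ' z.2).ordered z.1)
            continuous_toFun := .subtype_mk (.subtype_mk (by fun_prop) _) _
            map_zero_left := fun s ↦ ?_
            map_one_left := fun s ↦ ?_
            prop' := ?_ }⟩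
  · exact Subtype.ext (Subtype.ext (by simp [ofOrdered, LittleIntervals.ofOrdered]))
  · exact Subtype.ext (Subtype.ext (by simp [ofOrdered, LittleIntervals.ofOrdered]))
  · rintro t s (rfl | rfl) <;>
      exact Subtype.ext (Subtype.ext (by
        simp [ofOrdered, LittleIntervals.ofOrdered, ← add_smul]))

theorem continuous_comp {k n : ℕ} (m : Fin k → ℕ) (h : ∑ i, m i = n) :
    Continuous fun p : LittleIntervals₀ k × (∀ i, LittleIntervals₀ (m i)) ↦ comp m h p.1 p.2 := by
  refine .subtype_mk (.subtype_mk (continuous_pi fun j ↦ ?_) _) _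
  obtain ⟨⟨i, x⟩, rfl⟩ := (blockEquiv m h).surjective j
  change Continuous fun p : LittleIntervals₀ k × (∀ i, LittleIntervals₀ (m i)) ↦
    (comp m h p.1 p.2).1.1 _
  simp only [comp_blockEquiv]
  have ha : Continuous fun p : LittleIntervals₀ k × (∀ i, LittleIntervals₀ (m i)) ↦ p.1.1.1 i :=
    (continuous_apply i).comp (by fun_prop)
  have hb : Continuous fun p : LittleIntervals₀ k × (∀ i, LittleIntervals₀ (m i)) ↦
      (p.2 i).1.1 x := (continuous_apply x).comp (by fun_prop)
  fun_prop

end LittleIntervals₀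

theorem Operad.assoc_of_eq {X : ℕ → Type*} (C : Operad X) {k N n : ℕ} {m : Fin k → ℕ}
    (h : ∑ i, m i = N) {ι : Type*} {l : ι → ℕ} (q : Fin N → ι) (h₁ : ∑ j, l (q j) = n)
    {J : ∀ i, Fin (m i) → ι} (hJ : ∀ i x, q (blockEquiv m h ⟨i, x⟩) = J i x) {ns : Fin k → ℕ}
    (hs : ∀ i, ∑ x, l (J i x) = ns i) (h₂ : ∑ i, ns i = n) (a : X k) (b : ∀ i, X (m i))
    (c : ∀ j, X (l j)) :
    C.comp (fun j ↦ l (q j)) h₁ (C.comp m h a b) (fun j ↦ c (q j)) =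
      C.comp ns h₂ a (fun i ↦ C.comp (fun x ↦ l (J i x)) (hs i) (b i) (fun x ↦ c (J i x))) := by
  obtain rfl : (fun i x ↦ q (blockEquiv m h ⟨i, x⟩)) = J := funext₂ hJ
  obtain rfl : (fun i ↦ ∑ x, l (q (blockEquiv m h ⟨i, x⟩))) = ns := funext hs
  exact C.assoc m h (fun j ↦ l (q j)) h₁ h₂ a b (fun j ↦ c (q j))

/-! ### The universal cover of an operad -/

namespace GoodBasepoint

open LittleIntervals₀

variable {X : ℕ → Type*} [∀ n, TopologicalSpace (X n)] {C : TopOperad X} (η : GoodBasepoint C)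

/-- The lifting of `η` to the universal covers: the class of the image of the linear path from
`c_n` to `c`. -/
noncomputable def lift {n : ℕ} (c : LittleIntervals₀ n) : UnivCover (X n) (η.pt n) :=
  .mk ((linearPath (std n) c).map (η.continuous n))

theorem mk_map_eq_lift {n : ℕ} {c : LittleIntervals₀ n} (γ : Path (std n) c) :
    UnivCover.mk (e := η.pt n) (γ.map (η.continuous n)) = η.lift c :=
  congrArg (Sigma.mk _) (Path.Homotopic.Quotient.eq.2 ((homotopic γ _).map ⟨_, η.continuous n⟩))

theorem lift_std (n : ℕ) : η.lift (std n) = .base (η.pt n) :=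
  (η.mk_map_eq_lift (Path.refl _)).symm

variable {k n : ℕ} (m : Fin k → ℕ) (h : ∑ i, m i = n)

/-- The composition of the universal covers: the class of the linear path followed by the
composites of the two given classes of paths. -/
noncomputable def univComp (a : UnivCover (X k) (η.pt k))
    (b : ∀ i, UnivCover (X (m i)) (η.pt (m i))) : UnivCover (X n) (η.pt n) :=
  ⟨C.comp m h a.proj (fun i ↦ (b i).proj), (Path.Homotopic.Quotient.mk (η.linear m h)).trans
    ((C.continuous_comp m h).mapClass
      (Path.Homotopic.prod a.2 (Path.Homotopic.pi fun i ↦ (b i).2)))⟩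

theorem univComp_mk {x : X k} {y : ∀ i, X (m i)} (α : Path (η.pt k) x)
    (β : ∀ i, Path (η.pt (m i)) (y i)) :
    η.univComp m h (.mk α) (fun i ↦ .mk (β i)) =
      .mk ((η.linear m h).trans (C.compPath m h α β)) := by
  simp only [univComp, UnivCover.mk, UnivCover.proj, Path.Homotopic.pi_lift,
    Path.Homotopic.prod_lift]
  rfl

theorem univComp_base :
    η.univComp m h (.base _) (fun _ ↦ .base _) = .mk (η.linear m h) :=
  (η.univComp_mk m h _ _).trans (UnivCover.extend_refl (.mk (η.linear m h)))

theorem univComp_lift (a : LittleIntervals₀ k) (b : ∀ i, LittleIntervals₀ (m i)) :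
    η.univComp m h (η.lift a) (fun i ↦ η.lift (b i)) = η.lift (comp m h a b) := by
  let γ : Path (comp m h (std k) fun i ↦ std (m i)) (comp m h a b) :=
    ((linearPath (std k) a).prod (Path.pi fun i ↦ linearPath (std (m i)) (b i))).map
      (LittleIntervals₀.continuous_comp m h)
  refine (η.univComp_mk m h _ _).trans ?_
  rw [← η.mk_map_eq_lift ((linearPath _ _).trans γ)]
  refine UnivCover.mk_congr fun t ↦ ?_
  change _ = η.η n (((linearPath _ _).trans γ) t)
  simp only [Path.trans_apply]
  split_ifs
  · rfl
  · exact (η.map_comp m h _ _).symm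

variable (hp : ∀ n, IsCoveringMap (UnivCover.proj : UnivCover (X n) (η.pt n) → X n))
include hp

theorem eq_univComp {f : UnivCover (X k) (η.pt k) × (∀ i, UnivCover (X (m i)) (η.pt (m i))) →
      UnivCover (X n) (η.pt n)} (hf : KContinuous f)
    (hf_proj : ∀ z, (f z).proj = C.comp m h z.1.proj (fun i ↦ (z.2 i).proj))
    (hf_base : f (.base _, fun _ ↦ .base _) = .mk (η.linear m h)) :
    f = fun z ↦ η.univComp m h z.1 z.2 := by
  funext ⟨a, b⟩
  obtain ⟨_, α, rfl⟩ := a.exists_mk_eq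
  choose _ β hβ using fun i ↦ (b i).exists_mk_eq
  obtain rfl : (fun i ↦ .mk (β i)) = b := funext hβ
  let γ : Path ((.base _, fun _ ↦ .base _) : UnivCover (X k) (η.pt k) ×
      (∀ i, UnivCover (X (m i)) (η.pt (m i)))) (.mk α, fun i ↦ .mk (β i)) :=
    (((UnivCover.base _).liftPath α).prod
      (Path.pi fun i ↦ (UnivCover.base _).liftPath (β i))).cast rfl
        (congrArg₂ Prod.mk (UnivCover.base_extend α).symm
          (funext fun i ↦ (UnivCover.base_extend (β i)).symm))
  rw [η.univComp_mk]
  exact (UnivCover.extend_eq_of_path (hp n) (a := .mk (η.linear m h)) (δ := C.compPath m h α β)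
    ((hf.mapPath γ).cast hf_base.symm rfl) fun t ↦ hf_proj _).symm

variable [∀ n, LocallyPathConnectedSpace (X n)]

theorem kContinuous_univComp : KContinuous fun z : UnivCover (X k) (η.pt k) ×
    (∀ i, UnivCover (X (m i)) (η.pt (m i))) ↦ η.univComp m h z.1 z.2 := by
  have := C.t2
  have := C.compactlyGenerated
  have := fun n ↦ t2Space_of_isSeparatedMap (hp n).isSeparatedMap UnivCover.continuous_proj
  have := fun n ↦ compactlyCoherentSpace_of_isLocalHomeomorph (hp n).isLocalHomeomorph
  have := fun n ↦ locallyPathConnectedSpace_of_isLocalHomeomorph (hp n).isLocalHomeomorph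
  have := fun n ↦ UnivCover.simplyConnectedSpace (hp n)
  have := locallyPathConnectedSpace_compactCoherentification_pi
    (B := fun i ↦ UnivCover (X (m i)) (η.pt (m i)))
  have := locallyPathConnectedSpace_compactCoherentification_prod
    (A := UnivCover (X k) (η.pt k)) (Y := ∀ i, UnivCover (X (m i)) (η.pt (m i)))
  have h_proj : Continuous fun z : UnivCover (X k) (η.pt k) ×
      (∀ i, UnivCover (X (m i)) (η.pt (m i))) ↦ (z.1.proj, fun i ↦ (z.2 i).proj) :=
    (UnivCover.continuous_proj.comp continuous_fst).prodMk
      (continuous_pi fun i ↦ UnivCover.continuous_proj.comp (by fun_prop))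
  obtain ⟨F, hF, hF_base, hF_proj⟩ := KContinuous.exists_lift (hp n)
    ((C.continuous_comp m h).comp (.of_continuous h_proj))
    (a := (.base _, fun _ ↦ .base _)) (e := .mk (η.linear m h)) rfl
  exact η.eq_univComp m h hp hF (congrFun hF_proj) hF_base ▸ hF

theorem univComp_assoc {N : ℕ} (h : ∑ i, m i = N) (l : Fin N → ℕ) (h₁ : ∑ j, l j = n)
    (h₂ : ∑ i, ∑ x, l (blockEquiv m h ⟨i, x⟩) = n) (a : UnivCover (X k) (η.pt k))
    (b : ∀ i, UnivCover (X (m i)) (η.pt (m i))) (c : ∀ j, UnivCover (X (l j)) (η.pt (l j))) :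
    η.univComp l h₁ (η.univComp m h a b) c =
      η.univComp (fun i ↦ ∑ x, l (blockEquiv m h ⟨i, x⟩)) h₂ a
        (fun i ↦ η.univComp (fun x ↦ l (blockEquiv m h ⟨i, x⟩)) rfl (b i)
          (fun x ↦ c (blockEquiv m h ⟨i, x⟩))) := by
  let E := UnivCover (X k) (η.pt k) × (∀ i, UnivCover (X (m i)) (η.pt (m i))) ×
    (∀ j, UnivCover (X (l j)) (η.pt (l j)))
  have h_left : KContinuous fun z : E ↦ η.univComp l h₁ (η.univComp m h z.1 z.2.1) z.2.2 :=
    (η.kContinuous_univComp l h₁ hp).comp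
      (((η.kContinuous_univComp m h hp).comp (.of_continuous (f := fun z : E ↦ (z.1, z.2.1))
        (by fun_prop))).prodMk (.of_continuous (by fun_prop)))
  have h_right : KContinuous fun z : E ↦
      η.univComp (fun i ↦ ∑ x, l (blockEquiv m h ⟨i, x⟩)) h₂ z.1
        (fun i ↦ η.univComp (fun x ↦ l (blockEquiv m h ⟨i, x⟩)) rfl (z.2.1 i)
          (fun x ↦ z.2.2 (blockEquiv m h ⟨i, x⟩))) :=
    (η.kContinuous_univComp _ h₂ hp).comp
      ((KContinuous.of_continuous continuous_fst).prodMk (.pi fun i ↦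
        (η.kContinuous_univComp _ rfl hp).comp (.of_continuous (f := fun z : E ↦
          (z.2.1 i, fun x ↦ z.2.2 (blockEquiv m h ⟨i, x⟩))) (by fun_prop))))
  refine congrFun (h_left.eq_of_comp_eq (hp n) h_right
    (funext fun z ↦ C.assoc m h l h₁ h₂ _ _ _) (a := (.base _, fun _ ↦ .base _, fun _ ↦ .base _))
    ?_) (a, b, c)
  simp only [← lift_std, univComp_lift, comp_assoc m h l h₁ h₂]

theorem univComp_base_left (a : UnivCover (X n) (η.pt n)) :
    η.univComp (fun _ : Fin 1 ↦ n) (by simp) (.base _) (fun _ ↦ a) = a := by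
  have h_left : KContinuous fun a : UnivCover (X n) (η.pt n) ↦
      (η.univComp (fun _ : Fin 1 ↦ n) (by simp) (.base _) (fun _ ↦ a) :
        UnivCover (X n) (η.pt n)) :=
    (η.kContinuous_univComp _ _ hp).comp
      (.of_continuous (f := fun a ↦ (.base (η.pt 1), fun _ ↦ a)) (by fun_prop))
  refine congrFun (h_left.eq_of_comp_eq (hp n) (g := id) (.of_continuous continuous_id)
    (funext fun a ↦ ?_) (a := .base _) ?_) a
  · exact (congrArg (C.comp _ _ · _) η.map_one).trans (C.one_comp a.proj)
  · simp only [← lift_std, univComp_lift, std_one_comp, id]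

theorem univComp_base_right (a : UnivCover (X n) (η.pt n)) :
    η.univComp (fun _ : Fin n ↦ 1) (by simp) a (fun _ ↦ .base _) = a := by
  have h_left : KContinuous fun a : UnivCover (X n) (η.pt n) ↦
      (η.univComp (fun _ : Fin n ↦ 1) (by simp) a (fun _ ↦ .base _) :
        UnivCover (X n) (η.pt n)) :=
    (η.kContinuous_univComp _ _ hp).comp
      (.of_continuous (f := fun a ↦ (a, fun _ ↦ .base (η.pt 1))) (by fun_prop))
  refine congrFun (h_left.eq_of_comp_eq (hp n) (g := id) (.of_continuous continuous_id)
    (funext fun a ↦ ?_) (a := .base _) ?_) a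
  · exact (congrArg (C.comp _ _ _) (funext fun _ ↦ η.map_one)).trans (C.comp_one a.proj)
  · simp only [← lift_std, univComp_lift, comp_std_one, id]

/-- The operad of the universal covers of the pointed spaces `(C(n), e_n)`. -/
noncomputable def univCover : TopOperad fun n ↦ UnivCover (X n) (η.pt n) where
  one := .base _
  comp := η.univComp
  unique_zero := by
    have := C.unique_zero.some.instSubsingleton
    exact ⟨⟨⟨.base _⟩, fun _ ↦ Subsingleton.elim _ _⟩⟩
  assoc m h l h₁ h₂ := η.univComp_assoc m hp h l h₁ h₂
  one_comp := η.univComp_base_left hp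
  comp_one := η.univComp_base_right hp
  t2 n := by
    have := C.t2 n
    exact t2Space_of_isSeparatedMap (hp n).isSeparatedMap UnivCover.continuous_proj
  compactlyGenerated n := by
    have := C.t2 n
    have := C.compactlyGenerated n
    exact compactlyCoherentSpace_of_isLocalHomeomorph (hp n).isLocalHomeomorph
  continuous_comp m h := η.kContinuous_univComp m h hp

end GoodBasepoint

theorem OrbitPi1.mk_trans_smul_mk {G X : Type*} [TopologicalSpace X] [Group G] [MulAction G X]
    [ContinuousConstSMul G X] {e x y : X} (g : G) (δ : Path e x) (hx : g • y = x)
    (δ' : Path e y) :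
    mk g ((δ.cast rfl hx).trans (δ'.symm.map (continuous_const_smul g))) • UnivCover.mk δ' =
      UnivCover.mk δ := by
  subst hx
  exact connecting_smul g (.mk δ') (.mk δ) rfl

/-! ### The fundamental groups operad -/

namespace GoodBasepoint

variable {G : ℕ → Type*} [∀ n, Group (G n)] {𝒢 : GroupOperad G} {X : ℕ → Type*}
  [∀ n, TopologicalSpace (X n)] [∀ n, MulAction (G n) (X n)]
  [∀ n, ContinuousConstSMul (G n) (X n)] {C : GOperad 𝒢 X} (η : GoodBasepoint C.toTopOperad)
  {k n : ℕ} (m : Fin k → ℕ) (h : ∑ i, m i = n)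

/-- The composition of the fundamental groups operad: the element over `γ(σ; τ₁, …, τ_k)` that
makes the composition of the universal covers equivariant at the basepoints. -/
noncomputable def pi1Comp (s : OrbitPi1 (G k) (X k) (η.pt k))
    (t : ∀ i, OrbitPi1 (G (m i)) (X (m i)) (η.pt (m i))) : OrbitPi1 (G n) (X n) (η.pt n) :=
  .connecting (𝒢.comp m h s.toGroup fun i ↦ (t i).toGroup)
    (η.univComp (fun i ↦ m ((𝒢.perm s.toGroup).symm i)) (sum_perm h (𝒢.perm s.toGroup))
      (.base _) fun _ ↦ .base _)
    (η.univComp m h (s • .base _) fun i ↦ t i • .base _)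
    (C.smul_comp_smul m h s.toGroup (fun i ↦ (t i).toGroup) (η.pt k) fun i ↦ η.pt (m i))

theorem toGroup_pi1Comp (s : OrbitPi1 (G k) (X k) (η.pt k))
    (t : ∀ i, OrbitPi1 (G (m i)) (X (m i)) (η.pt (m i))) :
    (η.pi1Comp m h s t).toGroup = 𝒢.comp m h s.toGroup fun i ↦ (t i).toGroup := rfl

variable (hp : ∀ n, IsCoveringMap (UnivCover.proj : UnivCover (X n) (η.pt n) → X n))
  [∀ n, LocallyPathConnectedSpace (X n)]
include hp

theorem univComp_smul_smul (s : OrbitPi1 (G k) (X k) (η.pt k))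
    (t : ∀ i, OrbitPi1 (G (m i)) (X (m i)) (η.pt (m i))) (a : UnivCover (X k) (η.pt k))
    (b : ∀ i, UnivCover (X (m i)) (η.pt (m i))) :
    η.univComp m h (s • a) (fun i ↦ t i • b i) =
      η.pi1Comp m h s t • η.univComp (fun i ↦ m ((𝒢.perm s.toGroup).symm i))
        (sum_perm h (𝒢.perm s.toGroup)) a (fun i ↦ b ((𝒢.perm s.toGroup).symm i)) := by
  let E := UnivCover (X k) (η.pt k) × ∀ i, UnivCover (X (m i)) (η.pt (m i))
  have h_left : KContinuous fun z : E ↦ η.univComp m h (s • z.1) fun i ↦ t i • z.2 i :=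
    (η.kContinuous_univComp m h hp).comp
      (.of_continuous ((continuous_fst.const_smul s).prodMk
        (continuous_pi fun i ↦ ((continuous_apply i).comp continuous_snd).const_smul (t i))))
  have h_right : KContinuous fun z : E ↦
      η.pi1Comp m h s t • η.univComp (fun i ↦ m ((𝒢.perm s.toGroup).symm i))
        (sum_perm h (𝒢.perm s.toGroup)) z.1 (fun i ↦ z.2 ((𝒢.perm s.toGroup).symm i)) :=
    (KContinuous.of_continuous (continuous_const_smul (η.pi1Comp m h s t))).comp
      ((η.kContinuous_univComp _ _ hp).comp (.of_continuous (continuous_fst.prodMk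
        (continuous_pi fun i ↦ (continuous_apply ((𝒢.perm s.toGroup).symm i)).comp
          continuous_snd))))
  exact congrFun (h_left.eq_of_comp_eq (hp n) h_right
    (funext fun z ↦ C.smul_comp_smul m h s.toGroup (fun i ↦ (t i).toGroup) z.1.proj
      fun i ↦ (z.2 i).proj)
    (a := (.base _, fun _ ↦ .base _)) (OrbitPi1.connecting_smul ..).symm) (a, b)

theorem eq_pi1Comp_of_smul_eq {s : OrbitPi1 (G k) (X k) (η.pt k)}
    {t : ∀ i, OrbitPi1 (G (m i)) (X (m i)) (η.pt (m i))} {p : OrbitPi1 (G n) (X n) (η.pt n)}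
    (hpG : p.toGroup = 𝒢.comp m h s.toGroup fun i ↦ (t i).toGroup)
    (a : UnivCover (X k) (η.pt k)) (b : ∀ i, UnivCover (X (m i)) (η.pt (m i)))
    (hps : p • η.univComp (fun i ↦ m ((𝒢.perm s.toGroup).symm i))
      (sum_perm h (𝒢.perm s.toGroup)) a (fun i ↦ b ((𝒢.perm s.toGroup).symm i)) =
        η.univComp m h (s • a) fun i ↦ t i • b i) :
    p = η.pi1Comp m h s t :=
  OrbitPi1.eq_of_smul_eq hpG (hps.trans (η.univComp_smul_smul m h hp s t a b))

theorem pi1Comp_assoc {N : ℕ} (h : ∑ i, m i = N) (l : Fin N → ℕ) (h₁ : ∑ j, l j = n)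
    (h₂ : ∑ i, ∑ x, l (blockEquiv m h ⟨i, x⟩) = n) (s : OrbitPi1 (G k) (X k) (η.pt k))
    (t : ∀ i, OrbitPi1 (G (m i)) (X (m i)) (η.pt (m i)))
    (u : ∀ j, OrbitPi1 (G (l j)) (X (l j)) (η.pt (l j))) :
    η.pi1Comp l h₁ (η.pi1Comp m h s t) u =
      η.pi1Comp (fun i ↦ ∑ x, l (blockEquiv m h ⟨i, x⟩)) h₂ s
        (fun i ↦ η.pi1Comp (fun x ↦ l (blockEquiv m h ⟨i, x⟩)) rfl (t i)
          (fun x ↦ u (blockEquiv m h ⟨i, x⟩))) := by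
  refine η.eq_pi1Comp_of_smul_eq _ h₂ hp (𝒢.assoc m h l h₁ h₂ _ _ _) (.base _)
    (fun i ↦ η.univComp (fun x ↦ l (blockEquiv m h ⟨i, (𝒢.perm (t i).toGroup).symm x⟩))
      (sum_perm (m := fun x ↦ l (blockEquiv m h ⟨i, x⟩)) rfl _) (.base _) (fun _ ↦ .base _)) ?_
  simp only [← η.univComp_smul_smul _ _ hp (t _) _ (.base _) fun _ ↦ .base _]
  rw [← η.univComp_assoc m hp h l h₁ h₂ (s • .base _) (fun i ↦ t i • .base _)
    (fun j ↦ u j • .base _), η.univComp_smul_smul m h hp, η.univComp_smul_smul l h₁ hp]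
  refine congrArg _ (Eq.symm ?_)
  refine (η.univCover hp).assoc_of_eq _ _ _ (fun j x ↦ ?_) _ _ _ _ (fun _ ↦ .base _)
  exact (congrArg (fun π ↦ Equiv.symm π _) (𝒢.perm_comp m h _ _)).trans
    (symComp_symm_blockEquiv m h _ _ j x)

theorem one_pi1Comp (p : OrbitPi1 (G n) (X n) (η.pt n)) :
    η.pi1Comp (fun _ : Fin 1 ↦ n) (by simp) 1 (fun _ ↦ p) = p := by
  refine (η.eq_pi1Comp_of_smul_eq _ _ hp ?_ (.base _) (fun _ ↦ .base _) ?_).symm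
  · rw [_root_.map_one, ← 𝒢.one_eq, 𝒢.one_comp]
  · rw [one_smul (OrbitPi1 (G 1) (X 1) (η.pt 1))]
    exact (congrArg (p • ·) (η.univComp_base_left hp (.base _))).trans
      (η.univComp_base_left hp (p • .base _)).symm

theorem pi1Comp_one (p : OrbitPi1 (G n) (X n) (η.pt n)) :
    η.pi1Comp (fun _ : Fin n ↦ 1) (by simp) p (fun _ ↦ 1) = p := by
  refine (η.eq_pi1Comp_of_smul_eq _ _ hp ?_ (.base _) (fun _ ↦ .base _) ?_).symm
  · simp only [_root_.map_one, ← 𝒢.one_eq, 𝒢.comp_one]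
  · simp only [one_smul]
    exact (congrArg (p • ·) (η.univComp_base_right hp (.base _))).trans
      (η.univComp_base_right hp (p • .base _)).symm

theorem pi1Comp_mul (s s' : OrbitPi1 (G k) (X k) (η.pt k))
    (t t' : ∀ i, OrbitPi1 (G (m i)) (X (m i)) (η.pt (m i))) :
    η.pi1Comp m h (s * s') (fun i ↦ t i * t' i) =
      η.pi1Comp m h s t * η.pi1Comp (fun i ↦ m ((𝒢.perm s.toGroup).symm i))
        (sum_perm h (𝒢.perm s.toGroup)) s' (fun i ↦ t' ((𝒢.perm s.toGroup).symm i)) := by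
  refine (η.eq_pi1Comp_of_smul_eq m h hp ?_ (.base _) (fun _ ↦ .base _) ?_).symm
  · exact (𝒢.comp_mul m h s.toGroup s'.toGroup (fun i ↦ (t i).toGroup)
      fun i ↦ (t' i).toGroup).symm
  · simp only [mul_smul, η.univComp_smul_smul _ _ hp]
    exact congrArg (fun π : Equiv.Perm (Fin k) ↦ η.pi1Comp m h s t •
      (η.pi1Comp (fun i ↦ m ((𝒢.perm s.toGroup).symm i)) (sum_perm h (𝒢.perm s.toGroup)) s'
        fun i ↦ t' ((𝒢.perm s.toGroup).symm i)) • η.univComp (fun i ↦ m (π.symm i))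
          (sum_perm h π) (.base (η.pt k)) fun i ↦ .base (η.pt (m (π.symm i))))
      (𝒢.perm_mul s.toGroup s'.toGroup)

/-- The fundamental groups operad `π₁(C/𝒢)`. -/
noncomputable def pi1Operad : GroupOperad fun n ↦ OrbitPi1 (G n) (X n) (η.pt n) where
  one := 1
  comp := η.pi1Comp
  unique_zero := by
    have := 𝒢.unique_zero.some.instSubsingleton
    have := (η.univCover hp).unique_zero.some.instSubsingleton
    exact ⟨⟨⟨1⟩, fun p ↦ OrbitPi1.eq_of_smul_eq (z := .base _) (Subsingleton.elim _ _)
      (Subsingleton.elim _ _)⟩⟩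
  assoc m h := η.pi1Comp_assoc m hp h
  one_comp := η.one_pi1Comp hp
  comp_one := η.pi1Comp_one hp
  perm p := 𝒢.perm p.toGroup
  perm_mul p q := 𝒢.perm_mul p.toGroup q.toGroup
  perm_comp m h p q := 𝒢.perm_comp m h p.toGroup fun i ↦ (q i).toGroup
  one_eq := rfl
  comp_mul m h := η.pi1Comp_mul m h hp

/-- The operad of the universal covers as a `π₁(C/𝒢)`-operad. -/
noncomputable def univCoverOperad : GOperad (η.pi1Operad hp) fun n ↦ UnivCover (X n) (η.pt n) where
  __ := η.univCover hp
  smul_comp_smul m h := η.univComp_smul_smul m h hp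

theorem isFundamentalGroupOperad : C.IsFundamentalGroupOperad η (η.pi1Operad hp) where
  perm _ := rfl
  comp {k n} m h s t f g := by
    refine (η.eq_pi1Comp_of_smul_eq m h hp rfl (.base _) (fun _ ↦ .base _) ?_).symm
    simp only [OrbitPi1.mk_smul_base, univComp_mk, univComp_base]
    exact OrbitPi1.mk_trans_smul_mk (𝒢.comp m h s t) ((η.linear m h).trans (C.compPath m h f g))
      (C.smul_comp_smul m h s t (η.pt k) (fun i ↦ η.pt (m i))).symm
      (η.linear (fun i ↦ m ((𝒢.perm s).symm i)) (sum_perm h (𝒢.perm s)))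

theorem isUnivCoverOperad : C.IsUnivCoverOperad η (η.univCoverOperad hp) where
  one := rfl
  comp := η.univComp_mk

theorem isLift_iff {f : UnivCover (X k) (η.pt k) → (∀ i, UnivCover (X (m i)) (η.pt (m i))) →
    UnivCover (X n) (η.pt n)} : C.IsLift η m h f ↔ f = (η.univCoverOperad hp).comp m h := by
  refine ⟨fun hf ↦ funext₂ fun a b ↦ ?_, ?_⟩
  · exact congrFun (η.eq_univComp m h hp hf.continuous (fun z ↦ hf.proj z.1 z.2) hf.base) (a, b)
  · rintro rfl
    exact ⟨η.kContinuous_univComp m h hp, fun _ _ ↦ rfl, η.univComp_base m h⟩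

theorem isUniversalCover [∀ n, PathConnectedSpace (X n)] :
    GOperad.IsUniversalCover (fun _ ↦ OrbitPi1.toGroup) (η.univCoverOperad hp) C
      (fun _ ↦ UnivCover.proj) where
  isHom_group := ⟨fun _ ↦ rfl, η.toGroup_pi1Comp⟩
  surjective_group _ := OrbitPi1.surjective_toGroup
  isHom :=
    { continuous := fun _ ↦ UnivCover.continuous_proj
      map_smul := OrbitPi1.proj_smul
      map_one := η.map_one
      map_comp := fun _ _ _ _ ↦ rfl }
  isCoveringMap := hp
  surjective _ := UnivCover.surjective_proj
  simplyConnected n := UnivCover.simplyConnectedSpace (hp n)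

end GoodBasepoint

/-! ### The quotient operad -/

/-- The homeomorphism from an orbit space onto the target of a quotient map whose fibres are the
orbits. -/
noncomputable def orbitQuotientHomeomorph {G A B : Type*} [Group G] [MulAction G A]
    [TopologicalSpace A] [TopologicalSpace B] {f : C(A, B)} (hf : Topology.IsQuotientMap f)
    (h_fiber : ∀ a b, f a = f b ↔ a ∈ MulAction.orbit G b) :
    MulAction.orbitRel.Quotient G A ≃ₜ B :=
  (Homeomorph.Quotient.congrRight fun a b ↦ (h_fiber a b).symm).trans hf.homeomorph

namespace GOperad

variable {G : ℕ → Type*} [∀ n, Group (G n)] {𝒢 : GroupOperad G} {X : ℕ → Type*}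
  [∀ n, TopologicalSpace (X n)] [∀ n, MulAction (G n) (X n)]
  [∀ n, ContinuousConstSMul (G n) (X n)]

section Transport

variable (C : GOperad 𝒢 X) {Y : ℕ → Type*} [∀ n, TopologicalSpace (Y n)]
  [∀ n, MulAction (G n) (Y n)] [∀ n, ContinuousConstSMul (G n) (Y n)] (e : ∀ n, Y n ≃ₜ X n)
  (he : ∀ {n : ℕ} (g : G n) (y : Y n), e n (g • y) = g • e n y)

/-- The `𝒢`-operad structure on `Y` that makes the equivariant homeomorphisms `e` an isomorphism of
`𝒢`-operads from `Y` to `C`. -/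
def transport : GOperad 𝒢 Y where
  one := (e 1).symm C.one
  comp m h a b := (e _).symm (C.comp m h (e _ a) fun i ↦ e _ (b i))
  unique_zero := C.unique_zero.map fun u ↦ @Equiv.unique _ _ u (e 0).toEquiv
  assoc m h l h₁ h₂ a b c := by simp only [Homeomorph.apply_symm_apply, C.assoc m h l h₁ h₂]
  one_comp a := by simp only [Homeomorph.apply_symm_apply, C.one_comp, Homeomorph.symm_apply_apply]
  comp_one a := by simp only [Homeomorph.apply_symm_apply, C.comp_one, Homeomorph.symm_apply_apply]
  t2 n := by
    have := C.t2 n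
    exact (e n).symm.t2Space
  compactlyGenerated n := by
    have := C.t2 n
    have := C.compactlyGenerated n
    exact compactlyCoherentSpace_of_isLocalHomeomorph (e n).isLocalHomeomorph
  continuous_comp {k n} m h := (KContinuous.of_continuous (e n).symm.continuous).comp
    ((C.continuous_comp m h).comp (.of_continuous
      (f := fun p : Y k × (∀ i, Y (m i)) ↦ (e k p.1, fun i ↦ e (m i) (p.2 i))) (by fun_prop)))
  smul_comp_smul {k n} m h σ τ a b := (e n).injective <| by
    simp only [Homeomorph.apply_symm_apply, he, C.smul_comp_smul]

theorem isIso_transport : (C.transport e he).IsIso C fun n ↦ e n :=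
  ⟨{  continuous := fun n ↦ (e n).continuous
      map_smul := he
      map_one := (e 1).apply_symm_apply _
      map_comp := fun _ _ _ _ ↦ (e _).apply_symm_apply _ }, fun n ↦ (e n).isHomeomorph⟩

end Transport

variable {G' : ℕ → Type*} [∀ n, Group (G' n)] {𝒢' : GroupOperad G'} {X' : ℕ → Type*}
  [∀ n, TopologicalSpace (X' n)] [∀ n, MulAction (G' n) (X' n)]
  [∀ n, ContinuousConstSMul (G' n) (X' n)] {φ : ∀ n, G' n →* G n} {U : GOperad 𝒢' X'}
  {C : GOperad 𝒢 X} {Y : ℕ → Type*} [∀ n, TopologicalSpace (Y n)]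

theorem IsHomAlong.of_comp_isIso [∀ n, MulAction (G n) (Y n)]
    [∀ n, ContinuousConstSMul (G n) (Y n)] {Q : GOperad 𝒢 Y} {χ : ∀ n, X' n → Y n}
    {ψ : ∀ n, Y n → X n} (hψ : Q.IsIso C ψ) (hχ : IsHomAlong φ U C fun n ↦ ψ n ∘ χ n) :
    IsHomAlong φ U Q χ where
  continuous n := (hψ.2 n).isInducing.continuous_iff.2 (hχ.continuous n)
  map_smul g a := (hψ.2 _).injective ((hχ.map_smul g a).trans (hψ.1.map_smul _ _).symm)
  map_one := (hψ.2 1).injective (hχ.map_one.trans hψ.1.map_one.symm)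
  map_comp m h a b := (hψ.2 _).injective
    ((hχ.map_comp m h a b).trans (hψ.1.map_comp m h _ _).symm)

variable (C) in
theorem exists_isIso_of_homeomorph (e : ∀ n, Y n ≃ₜ X n) :
    ∃ (_ : ∀ n, MulAction (G n) (Y n)) (_ : ∀ n, ContinuousConstSMul (G n) (Y n))
      (Q : GOperad 𝒢 Y), Q.IsIso C fun n ↦ e n := by
  let : ∀ n, MulAction (G n) (Y n) := fun n ↦ (e n).toEquiv.mulAction (G n)
  have : ∀ n, ContinuousConstSMul (G n) (Y n) := fun n ↦
    ⟨fun g ↦ (e n).symm.continuous.comp ((e n).continuous.const_smul g)⟩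
  exact ⟨_, _, _, C.isIso_transport e fun _ _ ↦ (e _).apply_symm_apply _⟩

end GOperad

theorem mainTheorem5 {G : ℕ → Type*} [∀ n, Group (G n)] (𝒢 : GroupOperad G)
    {X : ℕ → Type*} [∀ n, TopologicalSpace (X n)] [∀ n, MulAction (G n) (X n)]
    [∀ n, ContinuousConstSMul (G n) (X n)] (C : GOperad 𝒢 X)
    (hpath : ∀ n, PathConnectedSpace (X n)) (hloc : ∀ n, LocallyPathConnectedSpace (X n))
    (hsemi : ∀ n, SemilocallySimplyConnected (X n)) (hcov : C.IsCovering)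
    (η : GoodBasepoint C.toTopOperad) :
    -- `π₁(C(n); e_n, G_n e_n)` is the fundamental group of the orbit space `C(n)/G_n`
    (∀ n, Function.Bijective (OrbitPi1.toLoop : OrbitPi1 (G n) (X n) (η.pt n) → _) ∧
      ∀ f g : OrbitPi1 (G n) (X n) (η.pt n), (f * g).toLoop = f.toLoop.trans g.toLoop) ∧
    -- the group operad `P = π₁(C/𝒢)` and the `P`-operad `U` of universal covers
    ∃ (P : GroupOperad fun n ↦ OrbitPi1 (G n) (X n) (η.pt n))
      (U : GOperad P fun n ↦ UnivCover (X n) (η.pt n)),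
      C.IsFundamentalGroupOperad η P ∧ C.IsUnivCoverOperad η U ∧
      -- the composition of `U` is the unique lifting of the composition of `C`
      (∀ {k n : ℕ} (m : Fin k → ℕ) (h : ∑ i, m i = n) f, C.IsLift η m h f ↔ f = U.comp m h) ∧
      -- `U` is a covering `P`-operad and a universal cover of `C`
      U.IsCovering ∧
      GOperad.IsUniversalCover (fun _ ↦ OrbitPi1.toGroup) U C (fun _ ↦ UnivCover.proj) ∧
      -- the quotient `𝒢`-operad `Q = U/π₁C`, and the isomorphism `Q ≅ C` induced by the projection
      ∃ (_ : ∀ n, MulAction (G n) (UnivCover.ModPi1 (G n) (X n) (η.pt n)))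
        (_ : ∀ n, ContinuousConstSMul (G n) (UnivCover.ModPi1 (G n) (X n) (η.pt n)))
        (Q : GOperad 𝒢 fun n ↦ UnivCover.ModPi1 (G n) (X n) (η.pt n)),
        GOperad.IsHomAlong (fun _ ↦ OrbitPi1.toGroup) U Q (fun _ ↦ Quotient.mk _) ∧
        ∃ ψ : ∀ n, UnivCover.ModPi1 (G n) (X n) (η.pt n) → X n,
          (∀ n (a : UnivCover (X n) (η.pt n)), ψ n (Quotient.mk _ a) = a.proj) ∧
          Q.IsIso C ψ := by
  have hq := fun n ↦ OrbitPi1.isQuotientCoveringMap_proj (G n) (hsemi n) (e := η.pt n)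
  have hp := fun n ↦ (hq n).isCoveringMap
  have h_univ := η.isUniversalCover hp
  let e := fun n ↦ orbitQuotientHomeomorph (f := ⟨UnivCover.proj, UnivCover.continuous_proj⟩)
    (hq n).toIsQuotientMap fun _ _ ↦ (hq n).apply_eq_iff_mem_orbit
  obtain ⟨I, J, Q, hQ⟩ := C.exists_isIso_of_homeomorph e
  exact ⟨fun n ↦ ⟨OrbitPi1.bijective_toLoop (hcov n), OrbitPi1.toLoop_mul⟩,
    η.pi1Operad hp, η.univCoverOperad hp, η.isFundamentalGroupOperad hp, η.isUnivCoverOperad hp,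
    fun m h _ ↦ η.isLift_iff m h hp,
    fun n ↦ OrbitPi1.isCoveringAction (hsemi n) (hcov n), h_univ,
    I, J, Q, .of_comp_isIso hQ h_univ.isHom, fun n ↦ e n, fun _ _ ↦ rfl, hQ⟩
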